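/- Let $n\ge 1$, let $N=(N_1,\dots,N_n)$ be an $n$-tuple of non-negative integers, and let $q,a,b,c,d,e,x_1,\dots,x_n$ be non-zero complex numbers. For a non-negative integer $k$ write $(a;q)_k=\prod_{j=0}^{k-1}(1-aq^j)$ and $(a_1,\dots,a_m;q)_k=(a_1;q)_k\cdots(a_m;q)_k$; for an $n$-tuple $k=(k_1,\dots,k_n)$ write $|k|=k_1+\cdots+k_n$. Assume that no denominator in the identity below vanishes, that is: $x_r\ne x_s$ for $r<s$; $(qx_r/x_s;q)_{N_r}\neq0$ for all $r,s$; $1-ax_r\ne0$, $(ax_rq^{1+N_r};q)_{|N|}\neq0$ and $(ax_rq/d;q)_{N_r}\ne0$ for all $r$; and $(aq/b,\,aq/c,\,aq/e,\,deq^{-|N|}/a;q)_{|N|}\neq0$. Then $$ \begin{aligned} &\sum_{\substack{0\le k_r\le N_r\\ r=1,\dots,n}}\Bigg(\prod_{1\le r<s\le n}\frac{1-q^{k_r-k_s}x_r/x_s}{1-x_r/x_s}\ \prod_{r,s=1}^n\frac{(q^{-N_s}x_r/x_s;q)_{k_r}}{(qx_r/x_s;q)_{k_r}}\\ &\qquad\times\prod_{r=1}^n\left[\frac{1-ax_rq^{k_r+|k|}}{1-ax_r}\,\frac{(ax_r;q)_{|k|}\,(bx_r,cx_r,ex_r;q)_{k_r}}{(ax_rq^{1+N_r};q)_{|k|}\,(ax_rq/d;q)_{k_r}}\right]\prod_{r=1}^n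 x_r^{-k_r}\\ &\qquad\times\frac{(d;q)_{|k|}}{(aq/b,aq/c,aq/e;q)_{|k|}}\left(\frac{a^2q^{2+|N|}}{bcde}\right)^{|k|}q^{\sum_{r<s}k_rk_s+\sum_{r=1}^n(r-1)k_r}\Bigg)\\ &=\frac{(aq/de;q)_{|N|}}{(aq/e;q)_{|N|}}\prod_{r=1}^n\frac{(ax_rq;q)_{N_r}}{(ax_rq/d;q)_{N_r}}\\ &\quad\times\sum_{\substack{0\le k_r\le N_r\\ r=1,\dots,n}}\Bigg(\prod_{1\le r<s\le n}\frac{1-q^{k_r-k_s}x_r/x_s}{1-x_r/x_s}\ \prod_{r,s=1}^n\frac{(q^{-N_s}x_r/x_s;q)_{k_r}}{(qx_r/x_s;q)_{k_r}}\\ &\qquad\times\frac{(d;q)_{|k|}\prod_{r=1}^n(ex_r,\,aq^{1+|k|-k_r}/bcx_r;q)_{k_r}}{(aq/b,aq/c,deq^{-|N|}/a;q)_{|k|}}\,q^{\sum_{r=1}^n rk_r}\Bigg). \end{aligned} $$ -/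

import Mathlib

/-- The `q`-shifted factorial `(a; q)_k = (1 - a)(1 - a q) ⋯ (1 - a q^(k-1))`, for `k : ℕ`. -/
noncomputable def qFac (a q : ℂ) (k : ℕ) : ℂ :=
  ∏ j ∈ Finset.range k, (1 - a * q ^ j)

/-- The type `A` Vandermonde product
`∏_{r < s} (1 - q^(k_r - k_s) x_r / x_s) / (1 - x_r / x_s)`. -/
noncomputable def vandermondeA {n : ℕ} (q : ℂ) (x : Fin n → ℂ) (k : Fin n → ℕ) : ℂ :=
  ∏ r : Fin n, ∏ s ∈ Finset.Ioi r,
    (1 - q ^ ((k r : ℤ) - (k s : ℤ)) * (x r / x s)) / (1 - x r / x s)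

/-- The double product `∏_{r, s} (q^(-N_s) x_r / x_s; q)_{k_r} / (q x_r / x_s; q)_{k_r}`,
over all pairs `(r, s)`, including `r = s`. -/
noncomputable def termFactorA {n : ℕ} (q : ℂ) (x : Fin n → ℂ) (N k : Fin n → ℕ) : ℂ :=
  ∏ r : Fin n, ∏ s : Fin n,
    qFac (q ^ (-(N s : ℤ)) * (x r / x s)) q (k r) / qFac (q * (x r / x s)) q (k r)

/-- The sum `|k| = k_1 + ⋯ + k_n` of the components of `k`. -/
def tupleSum {n : ℕ} (k : Fin n → ℕ) : ℕ := ∑ r : Fin n, k r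

/-- The box of all `k` with `0 ≤ k_r ≤ N_r` for every `r`. -/
def indexBox {n : ℕ} (N : Fin n → ℕ) : Finset (Fin n → ℕ) :=
  Fintype.piFinset fun r => Finset.range (N r + 1)

/-- The summand of the very-well-poised side. The index `r : Fin n` starts at `0`, so that
`∑ (r - 1) k_r` of the one-based notation is `∑ r k_r` here. -/
noncomputable def wellPoisedTerm {n : ℕ} (q a b c d e : ℂ) (x : Fin n → ℂ)
    (N k : Fin n → ℕ) : ℂ :=
  vandermondeA q x k * termFactorA q x N k
    * (∏ r : Fin n,
        (1 - a * x r * q ^ (k r + tupleSum k)) / (1 - a * x r)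
          * (qFac (a * x r) q (tupleSum k) * qFac (b * x r) q (k r) * qFac (c * x r) q (k r)
              * qFac (e * x r) q (k r))
          / (qFac (a * x r * q ^ (1 + N r)) q (tupleSum k) * qFac (a * x r * q / d) q (k r)))
    * (∏ r : Fin n, x r ^ (-(k r : ℤ)))
    * (qFac d q (tupleSum k)
        / (qFac (a * q / b) q (tupleSum k) * qFac (a * q / c) q (tupleSum k)
            * qFac (a * q / e) q (tupleSum k)))
    * (a ^ 2 * q ^ (2 + tupleSum N) / (b * c * d * e)) ^ tupleSum k
    * q ^ ((∑ r : Fin n, ∑ s ∈ Finset.Ioi r, k r * k s) + ∑ r : Fin n, (r : ℕ) * k r)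

/-- The summand of the balanced side. The index `r : Fin n` starts at `0`, so that
`∑ r k_r` of the one-based notation is `∑ (r + 1) k_r` here. -/
noncomputable def balancedTerm {n : ℕ} (q a b c d e : ℂ) (x : Fin n → ℂ)
    (N k : Fin n → ℕ) : ℂ :=
  vandermondeA q x k * termFactorA q x N k
    * (qFac d q (tupleSum k)
        * (∏ r : Fin n, qFac (e * x r) q (k r)
            * qFac (a * q ^ (1 + (tupleSum k : ℤ) - (k r : ℤ)) / (b * c * x r)) q (k r))
        / (qFac (a * q / b) q (tupleSum k) * qFac (a * q / c) q (tupleSum k)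
            * qFac (d * e * q ^ (-(tupleSum N : ℤ)) / a) q (tupleSum k)))
    * q ^ (∑ r : Fin n, ((r : ℕ) + 1) * k r)

/-! The argument is Bailey's derivation of a Watson-type transformation, carried out for type `A`
sums. For fixed `k` the factors of the very-well-poised summand that contain `b` and `c` are the
value of a balanced sum over `j ≤ k` (`sum_saalTerm`, used in `wellPoisedTerm_eq_sum`). Inserting it
gives a double sum. With `k = j + m`, the sum over `m` is, up to a coefficient depending on `j`, a
very-well-poised `₆φ₅` sum with `a`, `d`, `x_r`, `N_r` replaced by `a q^|j|`, `d q^|j|`, `x_r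
q^(j_r)`, `N_r - j_r` (`sixTerm_mul_saalTerm`). Summing it by `sum_sixTerm` leaves the balanced side
term by term (`shiftCoeff_mul`).

Both summations are proved by the same induction on `|N|`. A numerator parameter is written `v⁻¹`;
after clearing denominators both sides are polynomials in `v` of degree at most `|N|`, so `|N| + 1`
points suffice (`eq_of_eq_on_nodes`). At `v = x_r q^m` with `m < N_r` the factor `(v⁻¹ x_r;
q)_{k_r}` cuts the box at `k_r ≤ m`, and `v` and `N` exchange roles: the sum equals the one for `N`
with `N_r` replaced by `m`, taken at `v = x_r q^(N_r)`, where the induction hypothesis applies. At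
one further point only the term `k = N` survives and can be computed directly.

The interpolation needs some factors in `a x_r` and `c x_r` to be nonzero beyond what the theorem
assumes. The identity is therefore first proved for generic `a` and `c`
(`transformation_of_generic`) and then extended by continuity along `a + t`, `c + t`, `t → 0`. -/

/-! ### Elementary identities for `q`-shifted factorials. -/

theorem qFac_zero (a q : ℂ) : qFac a q 0 = 1 := by simp [qFac]

theorem qFac_one (a q : ℂ) : qFac a q 1 = 1 - a := by simp [qFac]

theorem qFac_add (a q : ℂ) (m n : ℕ) :
    qFac a q (m + n) = qFac a q m * qFac (a * q ^ m) q n := by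
  simp only [qFac, Finset.prod_range_add, pow_add, mul_assoc]

theorem qFac_succ' (a q : ℂ) (n : ℕ) :
    qFac a q (n + 1) = (1 - a) * qFac (a * q) q n := by
  rw [add_comm, qFac_add, qFac_one, pow_one]

theorem qFac_ne_zero_iff {a q : ℂ} {k : ℕ} :
    qFac a q k ≠ 0 ↔ ∀ j < k, 1 - a * q ^ j ≠ 0 := by
  simp [qFac, Finset.prod_ne_zero_iff]

theorem qFac_ne_zero_of_le {a q : ℂ} {k l : ℕ} (hkl : k ≤ l) (h : qFac a q l ≠ 0) :
    qFac a q k ≠ 0 :=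
  qFac_ne_zero_iff.2 fun j hj => qFac_ne_zero_iff.1 h j (hj.trans_le hkl)

theorem qFac_eq_zero {a q : ℂ} {j k : ℕ} (hj : j < k) (h : a * q ^ j = 1) : qFac a q k = 0 := by
  by_contra h0
  exact qFac_ne_zero_iff.1 h0 j hj (by rw [h, sub_self])

/-- Reversal of the order of the factors. -/
theorem qFac_reverse {a b q : ℂ} (hq : q ≠ 0) (k : ℕ) (h : a * b * q ^ k = q) :
    qFac a q k = (-a) ^ k * q ^ (k.choose 2) * qFac b q k := by
  have h1 : qFac b q k = ∏ j ∈ Finset.range k, (1 - b * q ^ (k - 1 - j)) :=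
    (Finset.prod_range_reflect (fun j => 1 - b * q ^ j) k).symm
  have h2 : (-a) ^ k * q ^ (k.choose 2) = ∏ j ∈ Finset.range k, (-a * q ^ j) := by
    rw [Finset.prod_mul_distrib, Finset.prod_pow_eq_pow_sum, Finset.sum_range_id,
      Nat.choose_two_right]
    simp
  rw [h1, h2, ← Finset.prod_mul_distrib, qFac]
  refine Finset.prod_congr rfl fun j hj => ?_
  have hj' := Finset.mem_range.1 hj
  -- Matched factors have reciprocal arguments, and `1 - u = -u (1 - u⁻¹)`.
  have h3 : a * q ^ j * (b * q ^ (k - 1 - j)) = 1 := by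
    refine mul_right_cancel₀ hq ?_
    have : q ^ k = q ^ j * q ^ (k - 1 - j) * q := by
      rw [← pow_add, ← pow_succ]; congr 1; omega
    rw [this] at h
    linear_combination h
  linear_combination -h3

/-! ### Distinctness of the interpolation nodes. -/

/-- The points `x_r q^i`, `0 ≤ i ≤ N_r`, are pairwise distinct. -/
def SeparatedNodes {n : ℕ} (q : ℂ) (x : Fin n → ℂ) (N : Fin n → ℕ) : Prop :=
  ∀ r s i j, i ≤ N r → j ≤ N s → x r * q ^ i = x s * q ^ j → r = s ∧ i = j

theorem SeparatedNodes.mono {n : ℕ} {q : ℂ} {x : Fin n → ℂ} {N M : Fin n → ℕ}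
    (h : SeparatedNodes q x N) (hM : ∀ r, M r ≤ N r) : SeparatedNodes q x M :=
  fun r s i j hi hj => h r s i j (hi.trans (hM r)) (hj.trans (hM s))

theorem SeparatedNodes.shift {n : ℕ} {q : ℂ} {x : Fin n → ℂ} {N : Fin n → ℕ}
    (h : SeparatedNodes q x N) {j : Fin n → ℕ} (hj : ∀ r, j r ≤ N r) :
    SeparatedNodes q (fun r => x r * q ^ j r) (fun r => N r - j r) := by
  intro r s i l hi hl he
  have hr := hj r
  have hs := hj s
  dsimp only at hi hl
  obtain ⟨h1, h2⟩ := h r s (j r + i) (j s + l) (by omega) (by omega)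
    (by simpa only [pow_add, mul_assoc] using he)
  subst h1
  exact ⟨rfl, by omega⟩

theorem SeparatedNodes.one_sub_div_ne_zero {n : ℕ} {q : ℂ} {x : Fin n → ℂ} {N : Fin n → ℕ}
    (h : SeparatedNodes q x N) {r s : Fin n} (hrs : r ≠ s) : 1 - x r / x s ≠ 0 := by
  intro h0
  have h1 : x r / x s = 1 := (sub_eq_zero.1 h0).symm
  have h2 : x s ≠ 0 := by rintro h2; simp [h2] at h1
  rw [div_eq_one_iff_eq h2] at h1
  exact hrs (h r s 0 0 (Nat.zero_le _) (Nat.zero_le _) (by simpa using h1)).1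

theorem SeparatedNodes.qFac_ne_zero {n : ℕ} {q : ℂ} {x : Fin n → ℂ} {N : Fin n → ℕ}
    (h : SeparatedNodes q x N) (hx : ∀ r, x r ≠ 0) {k : ℕ} {r : Fin n} (s : Fin n)
    (hk : k ≤ N r) : qFac (q * (x r / x s)) q k ≠ 0 := by
  refine qFac_ne_zero_iff.2 fun j hj h0 => ?_
  have h1 : x r * q ^ (j + 1) = x s * q ^ 0 := by
    have := hx s
    field_simp at h0
    linear_combination -h0
  exact absurd (h r s (j + 1) 0 (by omega) (Nat.zero_le _) h1).2 (by omega)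

/-- A coincidence `x_r q^i = x_s q^j` with `j < i` makes the factor `1 - q^(i-j) x_r / x_s` of `(q
x_r / x_s; q)_{N_r}` vanish; one with `i = j` forces `x_r = x_s`. Unlike the original hypotheses,
the resulting condition visibly passes to smaller boxes and to shifted nodes. -/
theorem separatedNodes_of_qFac_ne_zero {n : ℕ} {q : ℂ} {x : Fin n → ℂ} {N : Fin n → ℕ}
    (hq : q ≠ 0) (hx : ∀ r, x r ≠ 0) (hxx : ∀ r s, r < s → 1 - x r / x s ≠ 0)
    (hqx : ∀ r s, qFac (q * (x r / x s)) q (N r) ≠ 0) : SeparatedNodes q x N := by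
  have key : ∀ r s i j, i ≤ N r → j < i → x r * q ^ i ≠ x s * q ^ j := by
    intro r s i j hi hj he
    refine qFac_ne_zero_iff.1 (hqx r s) (i - j - 1) (by omega) ?_
    have h1 : q ^ i = q ^ j * (q * q ^ (i - j - 1)) := by
      rw [← pow_succ', ← pow_add]; congr 1; omega
    have h2 : x r * (q * q ^ (i - j - 1)) = x s := by
      refine mul_right_cancel₀ (pow_ne_zero j hq) ?_
      rw [← he, h1]; ring
    have := hx s
    field_simp
    linear_combination -h2
  intro r s i j hi hj he
  rcases lt_trichotomy i j with hij | hij | hij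
  · exact absurd he.symm (key s r j i hj hij)
  · subst hij
    have h1 : x r = x s := mul_right_cancel₀ (pow_ne_zero i hq) he
    refine ⟨?_, rfl⟩
    rcases lt_trichotomy r s with h | h | h
    · exact absurd (by rw [h1, div_self (hx s), sub_self]) (hxx r s h)
    · exact h
    · exact absurd (by rw [h1, div_self (hx s), sub_self]) (hxx s r h)
  · exact absurd he (key r s i j hi hij)

/-! ### Multi-indices and their sums. -/

theorem mem_indexBox {n : ℕ} {N k : Fin n → ℕ} : k ∈ indexBox N ↔ ∀ r, k r ≤ N r := by
  simp [indexBox]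

theorem tupleSum_mono {n : ℕ} {k N : Fin n → ℕ} (h : ∀ r, k r ≤ N r) : tupleSum k ≤ tupleSum N :=
  Finset.sum_le_sum fun r _ => h r

theorem tupleSum_lt {n : ℕ} {k N : Fin n → ℕ} (h : ∀ r, k r ≤ N r) (hne : k ≠ N) :
    tupleSum k < tupleSum N := by
  obtain ⟨r, hr⟩ := Function.ne_iff.1 hne
  exact Finset.sum_lt_sum (fun r _ => h r) ⟨r, Finset.mem_univ r, lt_of_le_of_ne (h r) hr⟩

theorem tupleSum_add {n : ℕ} (j m : Fin n → ℕ) :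
    tupleSum (fun r => j r + m r) = tupleSum j + tupleSum m :=
  Finset.sum_add_distrib

theorem le_tupleSum {n : ℕ} (k : Fin n → ℕ) (r : Fin n) : k r ≤ tupleSum k :=
  Finset.single_le_sum (fun s _ => Nat.zero_le (k s)) (Finset.mem_univ r)

theorem tupleSum_update {n : ℕ} (N : Fin n → ℕ) (r : Fin n) (m : ℕ) :
    tupleSum (Function.update N r m) + N r = tupleSum N + m := by
  unfold tupleSum
  rw [Finset.sum_update_of_mem (Finset.mem_univ r),
    ← Finset.sum_sdiff (Finset.subset_univ {r}) (f := N), Finset.sum_singleton]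
  omega

theorem prod_pow_tupleSum {n : ℕ} (z : ℂ) (k : Fin n → ℕ) : ∏ r, z ^ k r = z ^ tupleSum k :=
  Finset.prod_pow_eq_pow_sum _ _ _

/-! ### Polynomial functions and interpolation at the nodes. -/

/-- `f` is a polynomial function of degree at most `d`. -/
def IsPolyOfDegreeLE (d : ℕ) (f : ℂ → ℂ) : Prop :=
  ∃ p : Polynomial ℂ, p.natDegree ≤ d ∧ ∀ v, f v = p.eval v

namespace IsPolyOfDegreeLE

theorem mono {d e : ℕ} {f : ℂ → ℂ} (h : IsPolyOfDegreeLE d f) (hde : d ≤ e) :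
    IsPolyOfDegreeLE e f :=
  let ⟨p, hp, hf⟩ := h
  ⟨p, hp.trans hde, hf⟩

theorem const (c : ℂ) : IsPolyOfDegreeLE 0 fun _ => c :=
  ⟨Polynomial.C c, by simp, by simp⟩

theorem linear (b c : ℂ) : IsPolyOfDegreeLE 1 fun v => b + c * v :=
  ⟨Polynomial.C c * Polynomial.X + Polynomial.C b, Polynomial.natDegree_linear_le,
    fun v => by simp [add_comm]⟩

theorem mul {d e : ℕ} {f g : ℂ → ℂ} (hf : IsPolyOfDegreeLE d f) (hg : IsPolyOfDegreeLE e g) :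
    IsPolyOfDegreeLE (d + e) fun v => f v * g v := by
  obtain ⟨p, hp, hf⟩ := hf
  obtain ⟨p', hp', hg⟩ := hg
  exact ⟨p * p', Polynomial.natDegree_mul_le_of_le hp hp', fun v => by simp [hf, hg]⟩

theorem const_mul {d : ℕ} {f : ℂ → ℂ} (c : ℂ) (hf : IsPolyOfDegreeLE d f) :
    IsPolyOfDegreeLE d fun v => c * f v := by
  simpa using (const c).mul hf

theorem sum {d : ℕ} {ι : Type*} {s : Finset ι} {f : ι → ℂ → ℂ}
    (h : ∀ i ∈ s, IsPolyOfDegreeLE d (f i)) : IsPolyOfDegreeLE d fun v => ∑ i ∈ s, f i v := by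
  choose! p hp hf using h
  refine ⟨∑ i ∈ s, p i, Polynomial.natDegree_sum_le_of_forall_le s p hp, fun v => ?_⟩
  rw [Polynomial.eval_finsetSum]
  exact Finset.sum_congr rfl fun i hi => hf i hi v

theorem prod {ι : Type*} {s : Finset ι} {d : ι → ℕ} {f : ι → ℂ → ℂ}
    (h : ∀ i ∈ s, IsPolyOfDegreeLE (d i) (f i)) :
    IsPolyOfDegreeLE (∑ i ∈ s, d i) fun v => ∏ i ∈ s, f i v := by
  choose! p hp hf using h
  refine ⟨∏ i ∈ s, p i, (Polynomial.natDegree_prod_le s p).trans (Finset.sum_le_sum hp),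
    fun v => ?_⟩
  rw [Polynomial.eval_prod]
  exact Finset.prod_congr rfl fun i hi => hf i hi v

theorem prod_range {k : ℕ} {f : ℕ → ℂ → ℂ} (h : ∀ i, IsPolyOfDegreeLE 1 (f i)) :
    IsPolyOfDegreeLE k fun v => ∏ i ∈ Finset.range k, f i v := by
  simpa using prod (s := Finset.range k) (d := fun _ => 1) fun i _ => h i

theorem qFac (c q : ℂ) (k : ℕ) : IsPolyOfDegreeLE k fun v => qFac (c * v) q k := by
  refine prod_range (f := fun i v => 1 - c * v * q ^ i) fun i => ?_
  convert linear 1 (-(c * q ^ i)) using 2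
  ring

end IsPolyOfDegreeLE

/-- The monic version `∏_r ∏_{i < k_r} (v - x_r q^i)` of `∏_r (x_r / v; q)_{k_r}`. -/
noncomputable def nodeProd {n : ℕ} (q : ℂ) (x : Fin n → ℂ) (k : Fin n → ℕ) (v : ℂ) : ℂ :=
  ∏ r, ∏ i ∈ Finset.range (k r), (v - x r * q ^ i)

theorem isPolyOfDegreeLE_nodeProd {n : ℕ} (q : ℂ) (x : Fin n → ℂ) (k : Fin n → ℕ) :
    IsPolyOfDegreeLE (tupleSum k) (nodeProd q x k) := by
  refine IsPolyOfDegreeLE.prod (s := Finset.univ) (d := k)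
    (f := fun r v => ∏ i ∈ Finset.range (k r), (v - x r * q ^ i)) fun r _ => ?_
  refine IsPolyOfDegreeLE.prod_range (f := fun i v => v - x r * q ^ i) fun i => ?_
  convert IsPolyOfDegreeLE.linear (-(x r * q ^ i)) 1 using 2
  ring

theorem nodeProd_eq {n : ℕ} (q : ℂ) (x : Fin n → ℂ) (k : Fin n → ℕ) {v : ℂ} (hv : v ≠ 0) :
    nodeProd q x k v = v ^ tupleSum k * ∏ r, qFac (v⁻¹ * x r) q (k r) := by
  rw [nodeProd, ← prod_pow_tupleSum, ← Finset.prod_mul_distrib]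
  refine Finset.prod_congr rfl fun r _ => ?_
  have h : v ^ k r = ∏ _i ∈ Finset.range (k r), v := by simp
  rw [qFac, h, ← Finset.prod_mul_distrib]
  refine Finset.prod_congr rfl fun i _ => ?_
  field_simp

/-- Two polynomial functions of degree at most `|N|` which agree at the `|N| + 1` points
`x_r q^m`, `0 ≤ m < N_r`, and `v₀` are equal. -/
theorem eq_of_eq_on_nodes {n : ℕ} {q : ℂ} {x : Fin n → ℂ} {N : Fin n → ℕ}
    (hs : SeparatedNodes q x N) {v₀ : ℂ} (hv₀ : ∀ r, ∀ m < N r, v₀ ≠ x r * q ^ m) {f g : ℂ → ℂ}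
    (hf : IsPolyOfDegreeLE (tupleSum N) f) (hg : IsPolyOfDegreeLE (tupleSum N) g)
    (h : ∀ r, ∀ m < N r, f (x r * q ^ m) = g (x r * q ^ m)) (h₀ : f v₀ = g v₀) (v : ℂ) :
    f v = g v := by
  obtain ⟨p, hp, hf⟩ := hf
  obtain ⟨p', hp', hg⟩ := hg
  -- The value `none` indexes the extra point `v₀`, so the index type has `|N| + 1` elements.
  let node : Option (Σ r, Fin (N r)) → ℂ := fun o => o.elim v₀ fun i => x i.1 * q ^ (i.2 : ℕ)
  have hinj : Set.InjOn node (Finset.univ : Finset (Option (Σ r, Fin (N r)))) := by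
    rintro (_ | ⟨r, i⟩) - (_ | ⟨s, j⟩) - hij
    · rfl
    · exact absurd hij (hv₀ s j j.2)
    · exact absurd hij.symm (hv₀ r i i.2)
    · obtain ⟨h1, h2⟩ := hs r s i j i.2.le j.2.le hij
      subst h1
      rw [Fin.ext h2]
  have hcard : (Finset.univ : Finset (Option (Σ r, Fin (N r)))).card = tupleSum N + 1 := by
    simp [tupleSum]
  have hlt : ∀ p : Polynomial ℂ, p.natDegree ≤ tupleSum N →
      p.degree < (Finset.univ : Finset (Option (Σ r, Fin (N r)))).card := by
    intro p hp
    rw [hcard]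
    exact (Polynomial.degree_le_of_natDegree_le hp).trans_lt (by exact_mod_cast Nat.lt_succ_self _)
  have : p = p' := by
    refine Polynomial.eq_of_degrees_lt_of_eval_index_eq _ hinj (hlt p hp) (hlt p' hp') ?_
    rintro (_ | ⟨r, i⟩) -
    · rw [← hf, ← hg]; exact h₀
    · rw [← hf, ← hg]; exact h r i i.2
  rw [hf, hg, this]

/-! ### The type `A` weight `vandermondeA * termFactorA` and its factorization. -/

theorem prod_prod_eq_prod_diag_mul_prod_Ioi {M : Type*} [CommMonoid M] {n : ℕ}
    (f : Fin n → Fin n → M) :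
    ∏ r, ∏ s, f r s = ∏ r, (f r r * ∏ s ∈ Finset.Ioi r, f r s * f s r) := by
  have h : ∏ r, ∏ s, f r s = ∏ r, (f r r * ∏ s ∈ {r}ᶜ, f r s) :=
    Finset.prod_congr rfl fun r _ => (Fintype.prod_eq_mul_prod_compl r _)
  have h2 := Finset.prod_prod_Ioi_mul_eq_prod_prod_off_diag fun s r => f r s
  rw [h, Finset.prod_mul_distrib, Finset.prod_mul_distrib, h2]

theorem choose_two_add_succ_choose_two (k : ℕ) : k.choose 2 + (k + 1).choose 2 = k * k := by
  induction k with
  | zero => rfl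
  | succ k ih =>
    rw [Nat.choose_succ_succ' (k + 1) 1, Nat.choose_succ_succ' k 1] at *
    simp only [Nat.choose_one_right] at *
    nlinarith

theorem two_mul_succ_choose_two (k : ℕ) : 2 * (k + 1).choose 2 = k * k + k := by
  have h := choose_two_add_succ_choose_two k
  have h2 : (k + 1).choose 2 = k + k.choose 2 := by
    rw [Nat.choose_succ_succ' k 1, Nat.choose_one_right]
  omega

theorem tupleSum_mul_self {n : ℕ} (k : Fin n → ℕ) :
    tupleSum k * tupleSum k
      = ∑ r, k r * k r + 2 * ∑ r, ∑ s ∈ Finset.Ioi r, k r * k s := by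
  -- Taking values in `Multiplicative ℕ` turns the product decomposition into one for sums.
  have h := prod_prod_eq_prod_diag_mul_prod_Ioi
    (M := Multiplicative ℕ) fun r s => Multiplicative.ofAdd (k r * k s)
  simp only [← ofAdd_add, ← ofAdd_sum] at h
  have h' := Multiplicative.ofAdd.injective h
  rw [Finset.sum_add_distrib] at h'
  unfold tupleSum
  rw [Finset.sum_mul_sum, h', Finset.mul_sum]
  congr 1
  refine Finset.sum_congr rfl fun r _ => ?_
  rw [Finset.mul_sum]
  exact Finset.sum_congr rfl fun s _ => by ring

theorem sum_sum_Ioi_eq {n : ℕ} (k : Fin n → ℕ) :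
    ∑ r, ∑ s ∈ Finset.Ioi r, k s = ∑ r : Fin n, (r : ℕ) * k r := by
  rw [Finset.sum_comm' (t' := Finset.univ) (s' := fun s => Finset.Iio s) (by simp)]
  simp

theorem sum_pair_exponents {n : ℕ} (k : Fin n → ℕ) :
    ∑ r, ((k r + 1).choose 2 + ∑ s ∈ Finset.Ioi r, (k r * k s + k s))
      = (tupleSum k + 1).choose 2 + ∑ r : Fin n, (r : ℕ) * k r := by
  have h1 := two_mul_succ_choose_two (tupleSum k)
  have h2 : 2 * ∑ r, (k r + 1).choose 2 = ∑ r, k r * k r + tupleSum k := by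
    rw [Finset.mul_sum, tupleSum, ← Finset.sum_add_distrib]
    exact Finset.sum_congr rfl fun r _ => two_mul_succ_choose_two _
  have h3 := tupleSum_mul_self k
  simp only [Finset.sum_add_distrib, sum_sum_Ioi_eq]
  omega

/-- With `y = z q^j`, reversing the two factorials in `y⁻¹` turns both sides into `(z; q)_{i+1+j}`,
split after `i` factors on one side and after `j` on the other, times the same monomial. This is the
contribution of a pair `r < s` to the weight at `N = k`. -/
theorem qFac_pair {q y : ℂ} (hq : q ≠ 0) (hy : y ≠ 0) (i j : ℕ) :
    (1 - q ^ ((i : ℤ) - (j : ℤ)) * y) * (qFac (q ^ (-(j : ℤ)) * y) q i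
        * qFac (q ^ (-(i : ℤ)) * y⁻¹) q j) * q ^ (i * j + j)
      = (1 - y) * (qFac (q * y) q i * qFac (q * y⁻¹) q j) := by
  obtain ⟨z, rfl⟩ : ∃ z, y = z * q ^ j := ⟨y / q ^ j, by field_simp⟩
  have hz : z ≠ 0 := left_ne_zero_of_mul hy
  have e1 : q ^ ((i : ℤ) - (j : ℤ)) * (z * q ^ j) = z * q ^ i := by
    rw [zpow_sub₀ hq]; simp only [zpow_natCast]; field_simp
  have e2 : q ^ (-(j : ℤ)) * (z * q ^ j) = z := by
    rw [zpow_neg]; simp only [zpow_natCast]; field_simp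
  have e3 : q ^ (-(i : ℤ)) * (z * q ^ j)⁻¹ = (z * q ^ (i + j))⁻¹ := by
    rw [zpow_neg, pow_add]; simp only [zpow_natCast]; field_simp
  have r1 := qFac_reverse (a := (z * q ^ (i + j))⁻¹) (b := z * q ^ (i + 1)) hq j
    (by rw [pow_add, pow_add]; field_simp)
  have r2 := qFac_reverse (a := q * (z * q ^ j)⁻¹) (b := z) hq j (by field_simp)
  have s1 : qFac z q i * ((1 - z * q ^ i) * qFac (z * q ^ (i + 1)) q j)
      = qFac z q (i + 1 + j) := by
    rw [qFac_add, qFac_add, qFac_one, mul_assoc]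
  have s2 : qFac z q j * ((1 - z * q ^ j) * qFac (q * (z * q ^ j)) q i)
      = qFac z q (i + 1 + j) := by
    rw [show i + 1 + j = j + 1 + i by ring, qFac_add, qFac_add, qFac_one, mul_assoc,
      show q * (z * q ^ j) = z * q ^ (j + 1) by ring]
  have p : (-(z * q ^ (i + j))⁻¹) ^ j * q ^ (i * j + j) = (-(q * (z * q ^ j)⁻¹)) ^ j := by
    have : q ^ (i * j + j) = (q ^ (i + 1)) ^ j := by rw [← pow_mul]; ring_nf
    rw [this, ← mul_pow]
    congr 1
    rw [pow_add, pow_add]; field_simp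
  rw [e1, e2, e3, r1, r2]
  linear_combination (-(q * (z * q ^ j)⁻¹)) ^ j * q ^ j.choose 2 * (s1 - s2)
    + (1 - z * q ^ i) * qFac z q i * q ^ j.choose 2 * qFac (z * q ^ (i + 1)) q j * p

theorem qFac_diag {q : ℂ} (hq : q ≠ 0) (k : ℕ) :
    qFac (q ^ (-(k : ℤ))) q k * q ^ ((k + 1).choose 2) = (-1) ^ k * qFac q q k := by
  rw [qFac_reverse (b := q) hq k (by rw [zpow_neg, zpow_natCast]; field_simp), neg_pow]
  have : (q ^ (-(k : ℤ))) ^ k * (q ^ k.choose 2 * q ^ (k + 1).choose 2) = 1 := by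
    rw [← pow_add, choose_two_add_succ_choose_two, zpow_neg, zpow_natCast, inv_pow, ← pow_mul]
    exact inv_mul_cancel₀ (pow_ne_zero _ hq)
  linear_combination (-1) ^ k * qFac q q k * this

/-- The numerator of `termFactorA`. -/
noncomputable def numerA {n : ℕ} (q : ℂ) (x : Fin n → ℂ) (N k : Fin n → ℕ) : ℂ :=
  ∏ r : Fin n, ∏ s : Fin n, qFac (q ^ (-(N s : ℤ)) * (x r / x s)) q (k r)

/-- The denominator of `termFactorA`. -/
noncomputable def denomA {n : ℕ} (q : ℂ) (x : Fin n → ℂ) (k : Fin n → ℕ) : ℂ :=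
  ∏ r : Fin n, ∏ s : Fin n, qFac (q * (x r / x s)) q (k r)

theorem termFactorA_eq {n : ℕ} (q : ℂ) (x : Fin n → ℂ) (N k : Fin n → ℕ) :
    termFactorA q x N k = numerA q x N k / denomA q x k := by
  simp only [termFactorA, numerA, denomA, Finset.prod_div_distrib]

/-- The value `(-1)^|k| q^(-(|k|+1 choose 2) - ∑ (r-1) k_r)` of
`vandermondeA q x k * termFactorA q x k k`. -/
noncomputable def diagValue {n : ℕ} (q : ℂ) (k : Fin n → ℕ) : ℂ :=
  (-1) ^ tupleSum k / q ^ ((tupleSum k + 1).choose 2 + ∑ r : Fin n, (r : ℕ) * k r)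

theorem diagValue_ne_zero {n : ℕ} {q : ℂ} (hq : q ≠ 0) (k : Fin n → ℕ) : diagValue q k ≠ 0 :=
  div_ne_zero (pow_ne_zero _ (by norm_num)) (pow_ne_zero _ hq)

theorem denomA_ne_zero {n : ℕ} {q : ℂ} {x : Fin n → ℂ} {k : Fin n → ℕ}
    (hs : SeparatedNodes q x k) (hx : ∀ r, x r ≠ 0) : denomA q x k ≠ 0 :=
  Finset.prod_ne_zero_iff.2 fun _ _ => Finset.prod_ne_zero_iff.2 fun s _ =>
    hs.qFac_ne_zero hx s le_rfl

/-- The product splits into diagonal entries, handled by `qFac_diag`, and pairs `r < s`, handled by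
`qFac_pair`. All dependence on `x` cancels against `denomA`, leaving a sign and a power of `q`. -/
theorem vandermondeA_mul_numerA_self {n : ℕ} {q : ℂ} {x : Fin n → ℂ} {k : Fin n → ℕ}
    (hq : q ≠ 0) (hs : SeparatedNodes q x k) (hx : ∀ r, x r ≠ 0) :
    vandermondeA q x k * numerA q x k k = diagValue q k * denomA q x k := by
  rw [diagValue, div_mul_eq_mul_div, eq_div_iff (pow_ne_zero _ hq), ← sum_pair_exponents,
    numerA, denomA, prod_prod_eq_prod_diag_mul_prod_Ioi, prod_prod_eq_prod_diag_mul_prod_Ioi,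
    ← Finset.prod_pow_eq_pow_sum, ← prod_pow_tupleSum, vandermondeA, ← Finset.prod_mul_distrib,
    ← Finset.prod_mul_distrib, ← Finset.prod_mul_distrib]
  refine Finset.prod_congr rfl fun r _ => ?_
  have h1 := qFac_diag hq (k r)
  have h2 : (∏ s ∈ Finset.Ioi r, (1 - q ^ ((k r : ℤ) - (k s : ℤ)) * (x r / x s)) / (1 - x r / x s))
      * (∏ s ∈ Finset.Ioi r, qFac (q ^ (-(k s : ℤ)) * (x r / x s)) q (k r)
        * qFac (q ^ (-(k r : ℤ)) * (x s / x r)) q (k s))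
      * q ^ (∑ s ∈ Finset.Ioi r, (k r * k s + k s))
      = ∏ s ∈ Finset.Ioi r, qFac (q * (x r / x s)) q (k r) * qFac (q * (x s / x r)) q (k s) := by
    rw [← Finset.prod_pow_eq_pow_sum, ← Finset.prod_mul_distrib, ← Finset.prod_mul_distrib]
    refine Finset.prod_congr rfl fun s hrs => ?_
    have h3 := qFac_pair hq (div_ne_zero (hx r) (hx s)) (k r) (k s)
    rw [inv_div] at h3
    have h4 := hs.one_sub_div_ne_zero (Finset.mem_Ioi.1 hrs).ne
    field_simp at h3 ⊢
    exact h3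
  rw [div_self (hx r), mul_one, mul_one, pow_add]
  linear_combination qFac (q ^ (-(k r : ℤ))) q (k r) * q ^ (k r + 1).choose 2 * h2
    + (∏ s ∈ Finset.Ioi r, qFac (q * (x r / x s)) q (k r) * qFac (q * (x s / x r)) q (k s)) * h1

theorem vandermondeA_mul_termFactorA_self {n : ℕ} {q : ℂ} {x : Fin n → ℂ} {k : Fin n → ℕ}
    (hq : q ≠ 0) (hs : SeparatedNodes q x k) (hx : ∀ r, x r ≠ 0) :
    vandermondeA q x k * termFactorA q x k k = diagValue q k := by
  rw [termFactorA_eq, ← mul_div_assoc, vandermondeA_mul_numerA_self hq hs hx,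
    mul_div_cancel_right₀ _ (denomA_ne_zero hs hx)]

theorem numerA_self_ne_zero {n : ℕ} {q : ℂ} {x : Fin n → ℂ} {k : Fin n → ℕ}
    (hq : q ≠ 0) (hs : SeparatedNodes q x k) (hx : ∀ r, x r ≠ 0) : numerA q x k k ≠ 0 := by
  intro h
  have h1 := vandermondeA_mul_numerA_self hq hs hx
  rw [h, mul_zero] at h1
  exact mul_ne_zero (diagValue_ne_zero hq k) (denomA_ne_zero hs hx) h1.symm

/-- This removes the Vandermonde product and the denominator in favour of `numerA`, which is
multiplicative under `k = j + m` by `numerA_add`. -/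
theorem vandermondeA_mul_termFactorA {n : ℕ} {q : ℂ} {x : Fin n → ℂ} (N : Fin n → ℕ)
    {k : Fin n → ℕ} (hq : q ≠ 0) (hs : SeparatedNodes q x k) (hx : ∀ r, x r ≠ 0) :
    vandermondeA q x k * termFactorA q x N k
      = diagValue q k * numerA q x N k / numerA q x k k := by
  rw [termFactorA_eq, eq_div_iff (numerA_self_ne_zero hq hs hx), ← mul_div_assoc,
    div_mul_eq_mul_div, div_eq_iff (denomA_ne_zero hs hx)]
  linear_combination numerA q x N k * vandermondeA_mul_numerA_self hq hs hx

theorem numerA_add {n : ℕ} {q : ℂ} (hq : q ≠ 0) (x : Fin n → ℂ) {N j : Fin n → ℕ}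
    (hj : ∀ r, j r ≤ N r) (m : Fin n → ℕ) :
    numerA q x N (fun r => j r + m r)
      = numerA q x N j * numerA q (fun r => x r * q ^ j r) (fun r => N r - j r) m := by
  simp only [numerA, ← Finset.prod_mul_distrib]
  refine Finset.prod_congr rfl fun r _ => Finset.prod_congr rfl fun s _ => ?_
  rw [qFac_add]
  congr 2
  rw [Nat.cast_sub (hj s), neg_sub, zpow_sub₀ hq, zpow_neg]
  simp only [zpow_natCast]
  by_cases h : x s = 0
  · simp [h]
  · field_simp

theorem diagValue_add {n : ℕ} {q : ℂ} (hq : q ≠ 0) (j m : Fin n → ℕ) :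
    diagValue q (fun r => j r + m r) * q ^ (tupleSum j * tupleSum m)
      = diagValue q j * diagValue q m := by
  have h : (tupleSum j + tupleSum m + 1).choose 2
      = (tupleSum j + 1).choose 2 + (tupleSum m + 1).choose 2 + tupleSum j * tupleSum m := by
    have h1 := two_mul_succ_choose_two (tupleSum j)
    have h2 := two_mul_succ_choose_two (tupleSum m)
    have h3 := two_mul_succ_choose_two (tupleSum j + tupleSum m)
    nlinarith
  simp only [diagValue, tupleSum_add, mul_add, Finset.sum_add_distrib, h, pow_add]
  field_simp

/-- An analogue of `binom(N, k) binom(k, j) = binom(N, j) binom(N - j, k - j)`: once the weights are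
written through `numerA`, the factor belonging to the box `j + m` cancels. It is what permits the
interchange of summations. -/
theorem weight_mul_weight {n : ℕ} {q : ℂ} {x : Fin n → ℂ} {N j m : Fin n → ℕ}
    (hq : q ≠ 0) (hs : SeparatedNodes q x N) (hx : ∀ r, x r ≠ 0) (hj : ∀ r, j r ≤ N r)
    (hm : ∀ r, m r ≤ N r - j r) :
    (vandermondeA q x (fun r => j r + m r) * termFactorA q x N (fun r => j r + m r))
        * (vandermondeA q x j * termFactorA q x (fun r => j r + m r) j) * q ^ (tupleSum j * tupleSum m)
      = (vandermondeA q x j * termFactorA q x N j)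
        * (vandermondeA q (fun r => x r * q ^ j r) m
          * termFactorA q (fun r => x r * q ^ j r) (fun r => N r - j r) m) * diagValue q j := by
  have hsj := hs.mono hj
  have hjm : ∀ r, j r + m r ≤ N r := fun r => by have := hj r; have := hm r; omega
  have hsk : SeparatedNodes q x (fun r => j r + m r) := hs.mono hjm
  have hx' : ∀ r, x r * q ^ j r ≠ 0 := fun r => mul_ne_zero (hx r) (pow_ne_zero _ hq)
  have hsm : SeparatedNodes q (fun r => x r * q ^ j r) m := (hs.shift hj).mono hm
  rw [vandermondeA_mul_termFactorA _ hq hsk hx, vandermondeA_mul_termFactorA _ hq hsj hx,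
    vandermondeA_mul_termFactorA _ hq hsj hx, vandermondeA_mul_termFactorA _ hq hsm hx',
    numerA_add hq x hj, numerA_add hq x (N := fun r => j r + m r) (fun r => Nat.le_add_right _ _)]
  have h1 := numerA_self_ne_zero hq hsk hx
  rw [numerA_add hq x (fun r => Nat.le_add_right _ _)] at h1
  have h2 := left_ne_zero_of_mul h1
  have h3 := right_ne_zero_of_mul h1
  have h4 := numerA_self_ne_zero hq hsj hx
  simp only [Nat.add_sub_cancel_left] at h3 ⊢
  have := diagValue_add hq j m
  field_simp
  linear_combination numerA q x N j * numerA q (fun r => x r * q ^ j r) (fun r => N r - j r) m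
    * diagValue q j * this

/-! ### Exchanging the parameter `v` with a bound `N_r`. -/

theorem prod_update_eq {n : ℕ} (f : Fin n → ℕ → ℂ) (N : Fin n → ℕ) (r : Fin n) (m : ℕ) :
    ∏ s, f s (Function.update N r m s) = f r m * ∏ s ∈ {r}ᶜ, f s (N s) := by
  rw [Fintype.prod_eq_mul_prod_compl r, Function.update_self]
  congr 1
  refine Finset.prod_congr rfl fun s hs => ?_
  rw [Function.update_of_ne (by simpa using hs)]

/-- The `s = r` part of `numerA` is `∏ (v⁻¹ x_t; q)_{k_t}` at `v = x_r q^(N_r)`, so it has the same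
shape as the extra product, and `m` and `N_r` may trade places. -/
theorem numerA_swap {n : ℕ} {q : ℂ} (x : Fin n → ℂ) (N k : Fin n → ℕ) (r : Fin n) (m : ℕ) :
    numerA q x N k * ∏ t, qFac ((x r * q ^ m)⁻¹ * x t) q (k t)
      = numerA q x (Function.update N r m) k * ∏ t, qFac ((x r * q ^ N r)⁻¹ * x t) q (k t) := by
  have h : ∀ i : ℕ, ∏ t, qFac ((x r * q ^ i)⁻¹ * x t) q (k t)
      = ∏ t, qFac (q ^ (-(i : ℤ)) * (x t / x r)) q (k t) := by
    intro i
    refine Finset.prod_congr rfl fun t _ => ?_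
    rw [zpow_neg, zpow_natCast, mul_inv]
    congr 1; ring
  have h2 := prod_update_eq (fun s i => ∏ t, qFac (q ^ (-(i : ℤ)) * (x t / x s)) q (k t)) N r m
  have h3 := Fintype.prod_eq_mul_prod_compl r
    fun s => ∏ t, qFac (q ^ (-(N s : ℤ)) * (x t / x s)) q (k t)
  have h4 : ∀ M, numerA q x M k = ∏ s, ∏ t, qFac (q ^ (-(M s : ℤ)) * (x t / x s)) q (k t) :=
    fun M => Finset.prod_comm
  rw [h, h, h4, h4, h3, h2]
  ring

theorem update_le {n : ℕ} {N : Fin n → ℕ} {r : Fin n} {m : ℕ} (hm : m ≤ N r) (s : Fin n) :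
    Function.update N r m s ≤ N s := by
  rcases eq_or_ne s r with rfl | h
  · simpa using hm
  · simp [h]

/-- Terms agree by `numerA_swap`. The larger box contributes nothing more, since `(q^(-m); q)_{k_r}
= 0` for `k_r > m`. -/
theorem sum_weight_swap {n : ℕ} {q : ℂ} (hq : q ≠ 0) {x : Fin n → ℂ} (hx : ∀ r, x r ≠ 0)
    (N : Fin n → ℕ) (r : Fin n) {m : ℕ} (hm : m ≤ N r) (h : (Fin n → ℕ) → ℂ) :
    ∑ k ∈ indexBox N, vandermondeA q x k * termFactorA q x N k
        * (∏ t, qFac ((x r * q ^ m)⁻¹ * x t) q (k t)) * h k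
      = ∑ k ∈ indexBox (Function.update N r m),
        vandermondeA q x k * termFactorA q x (Function.update N r m) k
        * (∏ t, qFac ((x r * q ^ N r)⁻¹ * x t) q (k t)) * h k := by
  symm
  refine (Finset.sum_congr rfl fun k _ => ?_).trans (Finset.sum_subset ?_ ?_)
  · rw [termFactorA_eq, termFactorA_eq]
    linear_combination -vandermondeA q x k / denomA q x k * h k * numerA_swap x N k r m
  · intro k hk
    rw [mem_indexBox] at *
    exact fun s => (hk s).trans (update_le hm s)
  · intro k hk hk'
    have hr : m < k r := by
      by_contra hr
      refine hk' (mem_indexBox.2 fun s => ?_)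
      rcases eq_or_ne s r with rfl | hs
      · simpa using hr
      · simpa [hs] using mem_indexBox.1 hk s
    rw [Finset.prod_eq_zero (Finset.mem_univ r), mul_zero, zero_mul]
    refine qFac_eq_zero hr ?_
    have := hx r
    field_simp

/-- In the coordinate `r` both sides join to `(y x_r; q)_{m+|N|}`, because `m + |N|` is unchanged
when `m` and `N_r` are exchanged. This gives the compatibility of the `₆φ₅` value with the exchange.
-/
theorem qFac_swap {n : ℕ} (q y : ℂ) (x : Fin n → ℂ) (N : Fin n → ℕ) (r : Fin n) (m : ℕ) :
    qFac (y * (x r * q ^ m)) q (tupleSum N) * ∏ s, qFac (y * x s) q (Function.update N r m s)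
      = qFac (y * (x r * q ^ N r)) q (tupleSum (Function.update N r m))
        * ∏ s, qFac (y * x s) q (N s) := by
  have h3 := Fintype.prod_eq_mul_prod_compl r fun s => qFac (y * x s) q (N s)
  have h4 := qFac_add (y * x r) q m (tupleSum N)
  have h5 := qFac_add (y * x r) q (N r) (tupleSum (Function.update N r m))
  have h6 := tupleSum_update N r m
  rw [show N r + tupleSum (Function.update N r m) = m + tupleSum N by omega, h4] at h5
  rw [prod_update_eq (fun s i => qFac (y * x s) q i), h3, ← mul_assoc y, ← mul_assoc y]
  linear_combination (∏ s ∈ {r}ᶜ, qFac (y * x s) q (N s)) * h5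

/-! ### The very-well-poised `₆φ₅` summation. -/

/-- The part of the summand of the very-well-poised `₆φ₅` sum which does not depend on `N`
and `v`. -/
noncomputable def sixBase {n : ℕ} (q a d : ℂ) (x : Fin n → ℂ) (k : Fin n → ℕ) : ℂ :=
  (∏ r, (1 - a * x r * q ^ (k r + tupleSum k)) / (1 - a * x r) * qFac (a * x r) q (tupleSum k)
      / qFac (a * x r * q / d) q (k r))
    * qFac d q (tupleSum k) * q ^ (∑ r : Fin n, (r : ℕ) * k r)

/-- The summand of the very-well-poised `₆φ₅` sum, with parameter `e = v⁻¹`. -/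
noncomputable def sixTerm {n : ℕ} (q a d v : ℂ) (x : Fin n → ℂ) (N k : Fin n → ℕ) : ℂ :=
  vandermondeA q x k * termFactorA q x N k * (∏ r, qFac (v⁻¹ * x r) q (k r))
    * (sixBase q a d x k * (∏ r, qFac (a * x r * q ^ (1 + N r)) q (tupleSum k))⁻¹
      * (qFac (a * q * v) q (tupleSum k))⁻¹ * (a * q ^ (1 + tupleSum N) * v / d) ^ tupleSum k)

theorem sum_sixTerm_swap {n : ℕ} {q : ℂ} (hq : q ≠ 0) (a d : ℂ) {x : Fin n → ℂ}
    (hx : ∀ r, x r ≠ 0) (N : Fin n → ℕ) (r : Fin n) {m : ℕ} (hm : m ≤ N r) :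
    ∑ k ∈ indexBox N, sixTerm q a d (x r * q ^ m) x N k
      = ∑ k ∈ indexBox (Function.update N r m),
        sixTerm q a d (x r * q ^ N r) x (Function.update N r m) k := by
  unfold sixTerm
  rw [sum_weight_swap hq hx N r hm]
  refine Finset.sum_congr rfl fun k _ => ?_
  congr 1
  have h1 : a * q ^ (1 + tupleSum N) * (x r * q ^ m) / d
      = a * q ^ (1 + tupleSum (Function.update N r m)) * (x r * q ^ N r) / d := by
    have : q ^ (1 + tupleSum N) * q ^ m
        = q ^ (1 + tupleSum (Function.update N r m)) * q ^ N r := by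
      have := tupleSum_update N r m
      rw [← pow_add, ← pow_add]; congr 1; omega
    linear_combination a * x r / d * this
  have h2 := prod_update_eq (fun s i => qFac (a * x s * q ^ (1 + i)) q (tupleSum k)) N r m
  have h3 := Fintype.prod_eq_mul_prod_compl r
    fun s => qFac (a * x s * q ^ (1 + N s)) q (tupleSum k)
  have h4 : ∀ i, a * q * (x r * q ^ i) = a * x r * q ^ (1 + i) := fun i => by ring
  rw [h1, h2, h3, h4, h4]
  simp only [mul_inv]
  ring

/-- The evaluation at the extra point `v = 1 / (a q^|N|)`. There `v⁻¹ x_r = a x_r q^|N|`, so the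
factors in `a x_r` assemble into `(a x_r; q)_{|N|+N_r+1}`, and `(d; q)_|N|` reverses into `(a q v /
d; q)_|N|`. -/
theorem sixTerm_last {n : ℕ} {q a d v : ℂ} {x : Fin n → ℂ} {N : Fin n → ℕ} (hq : q ≠ 0)
    (hd : d ≠ 0) (hs : SeparatedNodes q x N) (hx : ∀ r, x r ≠ 0)
    (ha : ∀ r, ∀ i ≤ N r + tupleSum N, 1 - a * x r * q ^ i ≠ 0)
    (hv : a * v * q ^ tupleSum N = 1) :
    vandermondeA q x N * termFactorA q x N N * nodeProd q x N v
        * (sixBase q a d x N * (∏ r, qFac (a * x r * q ^ (1 + N r)) q (tupleSum N))⁻¹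
          * (a * q ^ (1 + tupleSum N) / d) ^ tupleSum N)
      = qFac (a * q / d * v) q (tupleSum N)
        * ∏ r, qFac (a * x r * q) q (N r) / qFac (a * x r * q / d) q (N r) := by
  have hv0 : v ≠ 0 := by rintro rfl; simp at hv
  have hvi : v⁻¹ = a * q ^ tupleSum N := by
    rw [inv_eq_iff_eq_inv]; exact eq_inv_of_mul_eq_one_left (by linear_combination hv)
  have h1 : (∏ r, (1 - a * x r * q ^ (N r + tupleSum N)) / (1 - a * x r)
        * qFac (a * x r) q (tupleSum N) / qFac (a * x r * q / d) q (N r))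
      * (∏ r, qFac (a * x r * q ^ (1 + N r)) q (tupleSum N))⁻¹
      * (∏ r, qFac (v⁻¹ * x r) q (N r))
      = ∏ r, qFac (a * x r * q) q (N r) / qFac (a * x r * q / d) q (N r) := by
    rw [← Finset.prod_inv_distrib, ← Finset.prod_mul_distrib, ← Finset.prod_mul_distrib]
    refine Finset.prod_congr rfl fun r _ => ?_
    have g1 : 1 - a * x r ≠ 0 := by simpa using ha r 0 (Nat.zero_le _)
    have g2 : qFac (a * x r * q ^ (1 + N r)) q (tupleSum N) ≠ 0 :=
      qFac_ne_zero_iff.2 fun i hi => by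
        rw [mul_assoc (a * x r), ← pow_add]; exact ha r _ (by omega)
    have e1 : qFac (a * x r) q (tupleSum N + N r + 1)
        = qFac (a * x r) q (tupleSum N) * qFac (v⁻¹ * x r) q (N r)
          * (1 - a * x r * q ^ (N r + tupleSum N)) := by
      rw [qFac_add, qFac_one, qFac_add, hvi, mul_right_comm a, add_comm (N r)]
    have e2 : qFac (a * x r) q (tupleSum N + N r + 1)
        = (1 - a * x r) * (qFac (a * x r * q) q (N r)
          * qFac (a * x r * q ^ (1 + N r)) q (tupleSum N)) := by
      rw [qFac_succ', add_comm (tupleSum N), qFac_add, mul_assoc (a * x r) q, ← pow_succ',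
        add_comm 1]
    rw [e1] at e2
    -- If this denominator vanishes, both sides are zero by the convention for division by zero.
    by_cases g3 : qFac (a * x r * q / d) q (N r) = 0
    · simp [g3]
    · generalize qFac (a * x r * q ^ (1 + N r)) q (tupleSum N) = z₁ at *
      generalize qFac (a * x r * q / d) q (N r) = z₂ at *
      generalize qFac (v⁻¹ * x r) q (N r) = z₃ at *
      field_simp
      linear_combination e2
  have h2 : diagValue q N * v ^ tupleSum N * (a * q ^ (1 + tupleSum N) / d) ^ tupleSum N
      * qFac d q (tupleSum N) * q ^ (∑ r : Fin n, (r : ℕ) * N r)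
      = qFac (a * q / d * v) q (tupleSum N) := by
    have e0 : v * (a * q ^ (1 + tupleSum N) / d) = q / d := by
      rw [pow_add, pow_one]; linear_combination q / d * hv
    have e1 : d * (a * q / d * v) * q ^ tupleSum N = q := by
      field_simp; linear_combination hv
    rw [qFac_reverse hq _ e1, diagValue, mul_assoc _ (v ^ _), ← mul_pow, e0, pow_add,
      Nat.choose_succ_succ' (tupleSum N) 1, Nat.choose_one_right, pow_add, neg_pow d, div_pow]
    field_simp
    rw [← pow_mul, mul_comm (tupleSum N) 2, pow_mul]; norm_num
  rw [vandermondeA_mul_termFactorA_self hq hs hx, nodeProd_eq q x N hv0, sixBase, ← h1, ← h2]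
  ring

theorem mul_div_mul_div_eq {A A' B B' P P' Q Q' : ℂ} (h1 : A * P' = A' * P)
    (h2 : B * Q' = B' * Q) (hA : A' ≠ 0) (hQ : Q ≠ 0) (hQ' : Q' ≠ 0) :
    A * (B' / A' * (P' / Q')) = P / Q * B := by
  field_simp
  linear_combination B' * Q * h1 - A' * P * h2

/-- The terminating very-well-poised `₆φ₅` summation of type `A`. -/
theorem sum_sixTerm {n : ℕ} {q a d : ℂ} {x : Fin n → ℂ} (hq : q ≠ 0) (ha0 : a ≠ 0) (hd : d ≠ 0)
    (hx : ∀ r, x r ≠ 0) (N : Fin n → ℕ) (hs : SeparatedNodes q x N)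
    (ha : ∀ r, ∀ i ≤ N r + tupleSum N, 1 - a * x r * q ^ i ≠ 0)
    (had : ∀ r, qFac (a * x r * q / d) q (N r) ≠ 0)
    {v : ℂ} (hv : v ≠ 0) (hav : qFac (a * q * v) q (tupleSum N) ≠ 0) :
    ∑ k ∈ indexBox N, sixTerm q a d v x N k
      = qFac (a * q / d * v) q (tupleSum N) / qFac (a * q * v) q (tupleSum N)
        * ∏ r, qFac (a * x r * q) q (N r) / qFac (a * x r * q / d) q (N r) := by
  induction hM : tupleSum N using Nat.strong_induction_on generalizing N v with
  | _ M ih =>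
  subst hM
  -- `F` is the sum multiplied by `(a q v; q)_|N|`: the power `v^|k|` turns `(v⁻¹ x_r; q)_{k_r}`
  -- into `nodeProd`, and the tail of `(a q v; q)_|N|` remains.
  let F : ℂ → ℂ := fun v => ∑ k ∈ indexBox N, (vandermondeA q x k * termFactorA q x N k
    * (sixBase q a d x k * (∏ r, qFac (a * x r * q ^ (1 + N r)) q (tupleSum k))⁻¹
      * (a * q ^ (1 + tupleSum N) / d) ^ tupleSum k))
      * (nodeProd q x k v * qFac (a * q * q ^ tupleSum k * v) q (tupleSum N - tupleSum k))
  let G : ℂ → ℂ := fun v => (∏ r, qFac (a * x r * q) q (N r) / qFac (a * x r * q / d) q (N r))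
    * qFac (a * q / d * v) q (tupleSum N)
  have hF : IsPolyOfDegreeLE (tupleSum N) F := by
    refine IsPolyOfDegreeLE.sum fun k hk => IsPolyOfDegreeLE.const_mul _ ?_
    refine ((isPolyOfDegreeLE_nodeProd q x k).mul (IsPolyOfDegreeLE.qFac _ q _)).mono ?_
    have := tupleSum_mono (mem_indexBox.1 hk)
    omega
  have hG : IsPolyOfDegreeLE (tupleSum N) G := (IsPolyOfDegreeLE.qFac _ q _).const_mul _
  have hFsum : ∀ w : ℂ, w ≠ 0 → qFac (a * q * w) q (tupleSum N) ≠ 0 →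
      F w = qFac (a * q * w) q (tupleSum N) * ∑ k ∈ indexBox N, sixTerm q a d w x N k := by
    intro w hw haw
    rw [Finset.mul_sum]
    refine Finset.sum_congr rfl fun k hk => ?_
    have hk' := tupleSum_mono (mem_indexBox.1 hk)
    have h1 := qFac_add (a * q * w) q (tupleSum k) (tupleSum N - tupleSum k)
    rw [Nat.add_sub_cancel' hk'] at h1
    have h2 := qFac_ne_zero_of_le hk' haw
    have h3 : a * q ^ (1 + tupleSum N) * w / d = a * q ^ (1 + tupleSum N) / d * w := by ring
    have h4 := mul_inv_cancel₀ h2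
    rw [nodeProd_eq q x k hw, sixTerm, h1, mul_right_comm _ (q ^ _) w, h3,
      mul_pow (a * q ^ (1 + tupleSum N) / d)]
    generalize qFac (a * q * w) q (tupleSum k) = z at *
    generalize (a * q ^ (1 + tupleSum N) / d) ^ tupleSum k = z' at *
    linear_combination (-(vandermondeA q x k * termFactorA q x N k
      * (∏ r, qFac (w⁻¹ * x r) q (k r)) * sixBase q a d x k
      * (∏ r, qFac (a * x r * q ^ (1 + N r)) q (tupleSum k))⁻¹ * z' * w ^ tupleSum k
      * qFac (a * q * w * q ^ tupleSum k) q (tupleSum N - tupleSum k))) * h4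
  have haq : ∀ r, ∀ m ≤ N r, qFac (a * q * (x r * q ^ m)) q (tupleSum N + N r - m) ≠ 0 := by
    intro r m hm
    refine qFac_ne_zero_iff.2 fun i hi => ?_
    have := ha r (1 + m + i) (by omega)
    rwa [pow_add, pow_add, pow_one, show a * x r * (q * q ^ m * q ^ i)
      = a * q * (x r * q ^ m) * q ^ i by ring] at this
  have key : ∀ w, F w = G w := by
    -- This `v₀` is the zero of the last factor of `(a q v; q)_|N|`, which is present in every term
    -- with `|k| < |N|`.
    refine eq_of_eq_on_nodes (v₀ := (a * q ^ tupleSum N)⁻¹) hs ?_ hF hG ?_ ?_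
    · intro r m hm h
      refine ha r (m + tupleSum N) (by omega) ?_
      have h1 : x r * q ^ m * (a * q ^ tupleSum N) = 1 := by
        rw [← h]; exact inv_mul_cancel₀ (mul_ne_zero ha0 (pow_ne_zero _ hq))
      rw [pow_add]; linear_combination -h1
    · intro r m hm
      have hle := fun s => update_le (N := N) (r := r) hm.le s
      have hlt : tupleSum (Function.update N r m) < tupleSum N := by
        have := tupleSum_update N r m; omega
      have hne : ∀ i, x r * q ^ i ≠ 0 := fun i => mul_ne_zero (hx r) (pow_ne_zero _ hq)
      have n1 : qFac (a * q * (x r * q ^ m)) q (tupleSum N) ≠ 0 :=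
        qFac_ne_zero_of_le (by omega) (haq r m hm.le)
      have n2 : qFac (a * q * (x r * q ^ N r)) q (tupleSum (Function.update N r m)) ≠ 0 :=
        qFac_ne_zero_of_le (by omega) (haq r (N r) le_rfl)
      have hle' : ∀ s, Function.update N r m s + tupleSum (Function.update N r m)
          ≤ N s + tupleSum N := fun s => Nat.add_le_add (hle s) hlt.le
      have hI := ih _ hlt (Function.update N r m) (hs.mono hle)
        (fun s i hi => ha s i (hi.trans (hle' s)))
        (fun s => qFac_ne_zero_of_le (hle s) (had s)) (hne (N r)) n2 rfl
      have s1 := qFac_swap q (a * q) x N r m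
      have s2 := qFac_swap q (a * q / d) x N r m
      have c1 : ∀ s, a * x s * q = a * q * x s := fun s => by ring
      have c2 : ∀ s, a * q * x s / d = a * q / d * x s := fun s => by ring
      simp only [c1, c2] at had hI
      rw [hFsum _ (hne m) n1, sum_sixTerm_swap hq a d hx N r hm.le, hI]
      simp only [G, c1, c2, Finset.prod_div_distrib]
      have p1 : ∏ s, qFac (a * q / d * x s) q (N s) ≠ 0 :=
        Finset.prod_ne_zero_iff.2 fun s _ => had s
      have p2 : ∏ s, qFac (a * q / d * x s) q (Function.update N r m s) ≠ 0 :=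
        Finset.prod_ne_zero_iff.2 fun s _ => qFac_ne_zero_of_le (hle s) (had s)
      exact mul_div_mul_div_eq s1 s2 n2 p1 p2
    · have hv0 : a * (a * q ^ tupleSum N)⁻¹ * q ^ tupleSum N = 1 := by field_simp
      have hlast := sixTerm_last hq hd hs hx ha hv0
      simp only [F, G]
      rw [Finset.sum_eq_single_of_mem N (mem_indexBox.2 fun _ => le_rfl), Nat.sub_self, qFac_zero]
      · linear_combination hlast
      · intro k hk hkN
        have := tupleSum_lt (mem_indexBox.1 hk) hkN
        rw [qFac_eq_zero (j := tupleSum N - tupleSum k - 1) (by omega), mul_zero, mul_zero]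
        have h1 : q ^ tupleSum N = q * q ^ tupleSum k * q ^ (tupleSum N - tupleSum k - 1) := by
          rw [← pow_succ', ← pow_add]; congr 1; omega
        rw [h1] at hv0 ⊢
        linear_combination hv0
  have h1 := key v
  rw [hFsum v hv hav] at h1
  rw [div_mul_eq_mul_div, eq_div_iff hav, mul_comm, h1, mul_comm]

/-! ### The balanced summation. -/

/-- The exponent `∑_{r < s} k_r k_s`. -/
def crossSum {n : ℕ} (k : Fin n → ℕ) : ℕ := ∑ r : Fin n, ∑ s ∈ Finset.Ioi r, k r * k s

theorem crossSum_update {n : ℕ} (N : Fin n → ℕ) (r : Fin n) (m δ : ℕ) (h : N r = m + δ) :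
    crossSum N + δ * m
      = crossSum (Function.update N r m) + δ * tupleSum (Function.update N r m) := by
  have h1 := tupleSum_mul_self N
  have h2 := tupleSum_mul_self (Function.update N r m)
  have h3 := tupleSum_update N r m
  have h4 : ∑ s, Function.update N r m s * Function.update N r m s + N r * N r
      = ∑ s, N s * N s + m * m := by
    rw [Fintype.sum_eq_add_sum_compl r, Fintype.sum_eq_add_sum_compl r fun s => N s * N s,
      Function.update_self, Finset.sum_congr rfl fun s hs => ?_]
    · ring
    · rw [Function.update_of_ne (by simpa using hs)]
  have h5 : tupleSum N = tupleSum (Function.update N r m) + δ := by omega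
  rw [h] at h4
  rw [h5] at h1
  unfold crossSum
  nlinarith

/-- The summand of the balanced sum, with parameters `A = v⁻¹`, `B`, `C`, `D`. -/
noncomputable def saalTerm {n : ℕ} (q B C D v : ℂ) (x : Fin n → ℂ) (N k : Fin n → ℕ) : ℂ :=
  vandermondeA q x k * termFactorA q x N k * (∏ r, qFac (v⁻¹ * x r) q (k r))
    * ((∏ r, qFac (B * q ^ (tupleSum k - k r) / x r) q (k r))
        * q ^ (∑ r : Fin n, ((r : ℕ) + 1) * k r)
        / (qFac C q (tupleSum k) * qFac D q (tupleSum k)))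

/-- The value of the balanced sum. -/
noncomputable def saalValue {n : ℕ} (q B C D : ℂ) (x : Fin n → ℂ) (N : Fin n → ℕ) : ℂ :=
  B ^ tupleSum N * (∏ r, x r ^ N r)⁻¹ * q ^ crossSum N
    * ((∏ r, qFac (D / B * x r) q (N r)) * ∏ r, qFac (C / B * x r) q (N r))
    / (qFac C q (tupleSum N) * qFac D q (tupleSum N))

/-- Lowering `N_r` to `m = N_r - δ` removes `δ` factors from each of two numerators and two
denominators. By the balancing condition each removed numerator block is the reversal of a removed
denominator block, and the monomials left over account for the change in `crossSum`. -/
theorem saalValue_swap {n : ℕ} {q B C D : ℂ} {x : Fin n → ℂ} {N : Fin n → ℕ} (hq : q ≠ 0)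
    (hB : B ≠ 0) (hx : ∀ r, x r ≠ 0) (r : Fin n) {m : ℕ} (hm : m ≤ N r)
    (hD : D * C * (x r * q ^ m) * q ^ tupleSum N = B * q) (hCN : qFac C q (tupleSum N) ≠ 0)
    (hDN : qFac D q (tupleSum N) ≠ 0) :
    saalValue q B C D x N = saalValue q B C D x (Function.update N r m) := by
  obtain ⟨δ, hδ⟩ := Nat.exists_eq_add_of_le hm
  have hN : tupleSum N = tupleSum (Function.update N r m) + δ := by
    have := tupleSum_update N r m; omega
  have hcross := crossSum_update N r m δ hδ
  have hC : C ≠ 0 := by rintro rfl; simp [hB, hq] at hD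
  have hD0 : D ≠ 0 := by rintro rfl; simp [hB, hq] at hD
  set M := tupleSum (Function.update N r m) with hM
  have f1 := fun (y : ℂ) => prod_update_eq (fun s i => qFac (y * x s) q i) N r m
  have f2 := fun (y : ℂ) => Fintype.prod_eq_mul_prod_compl r fun s => qFac (y * x s) q (N s)
  have f3 := prod_update_eq (fun s i => x s ^ i) N r m
  have f4 := Fintype.prod_eq_mul_prod_compl r fun s => x s ^ N s
  have f5 : ∏ s ∈ {r}ᶜ, x s ^ N s ≠ 0 :=
    Finset.prod_ne_zero_iff.2 fun s _ => pow_ne_zero _ (hx s)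
  have hr := hx r
  rw [hN, qFac_add] at hCN hDN
  rw [hN] at hD
  have g1 : qFac (D / B * x r * q ^ m) q δ
      = (-(D / B * x r * q ^ m)) ^ δ * q ^ δ.choose 2 * qFac (C * q ^ M) q δ := by
    refine qFac_reverse hq δ ?_
    rw [pow_add] at hD
    field_simp
    linear_combination hD
  have g2 : qFac (C / B * x r * q ^ m) q δ
      = (-(C / B * x r * q ^ m)) ^ δ * q ^ δ.choose 2 * qFac (D * q ^ M) q δ := by
    refine qFac_reverse hq δ ?_
    rw [pow_add] at hD
    field_simp
    linear_combination hD
  have g3 : B ^ δ * (x r ^ δ)⁻¹ * q ^ crossSum N * ((-(D / B * x r * q ^ m)) ^ δ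
      * q ^ δ.choose 2 * ((-(C / B * x r * q ^ m)) ^ δ * q ^ δ.choose 2))
      = q ^ crossSum (Function.update N r m) := by
    have e1 : B * (x r)⁻¹ * (-(D / B * x r * q ^ m)) * (-(C / B * x r * q ^ m)) * q ^ (M + δ)
        = q ^ m * q := by
      field_simp
      linear_combination hD
    have e2 : q ^ crossSum N * (q ^ m) ^ δ
        = q ^ crossSum (Function.update N r m) * (q ^ M) ^ δ := by
      rw [← pow_mul, ← pow_mul, ← pow_add, ← pow_add, mul_comm m, mul_comm M, hcross]
    have e3 : q ^ δ.choose 2 * q ^ δ.choose 2 * q ^ δ = (q ^ δ) ^ δ := by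
      have h1 := two_mul_succ_choose_two δ
      have h2 := choose_two_add_succ_choose_two δ
      rw [← pow_add, ← pow_add, ← pow_mul]; congr 1; omega
    have e4 := congrArg (· ^ δ) e1
    simp only [mul_pow, pow_add, inv_pow] at e4
    refine mul_right_cancel₀ (pow_ne_zero δ (pow_ne_zero (M + δ) hq)) ?_
    rw [pow_add, mul_pow]
    linear_combination q ^ crossSum N * q ^ δ.choose 2 * q ^ δ.choose 2 * e4
      + q ^ δ.choose 2 * q ^ δ.choose 2 * q ^ δ * e2
      + q ^ crossSum (Function.update N r m) * (q ^ M) ^ δ * e3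
  have n1 := left_ne_zero_of_mul hCN
  have n2 := right_ne_zero_of_mul hCN
  have n3 := left_ne_zero_of_mul hDN
  have n4 := right_ne_zero_of_mul hDN
  unfold saalValue
  rw [← hM, hN, f1, f1, f2, f2, f3, f4, hδ, qFac_add (D / B * x r), qFac_add (C / B * x r),
    g1, g2, qFac_add C, qFac_add D, ← g3, pow_add B, pow_add (x r)]
  generalize qFac (C * q ^ M) q δ = z₁ at *
  generalize qFac (D * q ^ M) q δ = z₂ at *
  generalize qFac C q M = z₃ at *
  generalize qFac D q M = z₄ at *
  generalize (-(D / B * x r * q ^ m)) ^ δ = z₅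
  generalize (-(C / B * x r * q ^ m)) ^ δ = z₆
  generalize D / B = z₇
  generalize C / B = z₈
  field_simp

theorem sum_saalTerm_swap {n : ℕ} {q : ℂ} (hq : q ≠ 0) (B C D : ℂ) {x : Fin n → ℂ}
    (hx : ∀ r, x r ≠ 0) (N : Fin n → ℕ) (r : Fin n) {m : ℕ} (hm : m ≤ N r) :
    ∑ k ∈ indexBox N, saalTerm q B C D (x r * q ^ m) x N k
      = ∑ k ∈ indexBox (Function.update N r m),
        saalTerm q B C D (x r * q ^ N r) x (Function.update N r m) k :=
  sum_weight_swap hq hx N r hm _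

/-- Reversing each factorial brings `x_r` into the numerator; the signs cancel against `diagValue`,
and the exponents of `q` collapse to `crossSum N`. -/
theorem saalTerm_last {n : ℕ} {q B : ℂ} {x : Fin n → ℂ} {N : Fin n → ℕ} (hq : q ≠ 0)
    (hB : B ≠ 0) (hs : SeparatedNodes q x N) (hx : ∀ r, x r ≠ 0) :
    vandermondeA q x N * termFactorA q x N N
        * ((∏ r, qFac (B * q ^ (tupleSum N - N r) / x r) q (N r))
          * q ^ (∑ r : Fin n, ((r : ℕ) + 1) * N r))
      = B ^ tupleSum N * (∏ r, x r ^ N r)⁻¹ * q ^ crossSum N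
        * ∏ r, qFac (q / (q ^ tupleSum N * B) * x r) q (N r) := by
  have h1 : ∏ r, qFac (B * q ^ (tupleSum N - N r) / x r) q (N r)
      = (-1) ^ tupleSum N * B ^ tupleSum N * (∏ r, x r ^ N r)⁻¹
        * q ^ (∑ r, ((tupleSum N - N r) * N r + (N r).choose 2))
        * ∏ r, qFac (q / (q ^ tupleSum N * B) * x r) q (N r) := by
    rw [← prod_pow_tupleSum, ← prod_pow_tupleSum, ← Finset.prod_pow_eq_pow_sum,
      ← Finset.prod_inv_distrib, ← Finset.prod_mul_distrib, ← Finset.prod_mul_distrib,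
      ← Finset.prod_mul_distrib, ← Finset.prod_mul_distrib]
    refine Finset.prod_congr rfl fun r _ => ?_
    have hr := hx r
    rw [qFac_reverse (b := q / (q ^ tupleSum N * B) * x r) hq]
    · rw [show -(B * q ^ (tupleSum N - N r) / x r)
        = (-1) * B * (x r)⁻¹ * q ^ (tupleSum N - N r) by ring, mul_pow, mul_pow, mul_pow,
        ← pow_mul, inv_pow, pow_add]
      ring
    · have : q ^ tupleSum N = q ^ (tupleSum N - N r) * q ^ N r := by
        rw [← pow_add, Nat.sub_add_cancel (le_tupleSum N r)]
      rw [this]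
      field_simp
  have h2 : ∑ r, ((tupleSum N - N r) * N r + (N r).choose 2) + ∑ r : Fin n, ((r : ℕ) + 1) * N r
      = crossSum N + ((tupleSum N + 1).choose 2 + ∑ r : Fin n, (r : ℕ) * N r) := by
    have e1 : ∑ r, (tupleSum N - N r) * N r + ∑ r, N r * N r = tupleSum N * tupleSum N := by
      rw [← Finset.sum_add_distrib]
      conv_rhs => rw [tupleSum, Finset.mul_sum]
      refine Finset.sum_congr rfl fun r _ => ?_
      rw [← add_mul, Nat.sub_add_cancel (le_tupleSum N r), tupleSum]
    have e2 : 2 * ∑ r, (N r).choose 2 + tupleSum N = ∑ r, N r * N r := by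
      rw [Finset.mul_sum, tupleSum, ← Finset.sum_add_distrib]
      refine Finset.sum_congr rfl fun r _ => ?_
      have h1 := two_mul_succ_choose_two (N r)
      have h2 := choose_two_add_succ_choose_two (N r)
      omega
    have e3 := tupleSum_mul_self N
    have e4 := two_mul_succ_choose_two (tupleSum N)
    have e5 : ∑ r : Fin n, ((r : ℕ) + 1) * N r = ∑ r : Fin n, (r : ℕ) * N r + tupleSum N := by
      rw [tupleSum, ← Finset.sum_add_distrib]
      exact Finset.sum_congr rfl fun r _ => by ring
    rw [Finset.sum_add_distrib, e5, crossSum]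
    omega
  have h3 : diagValue q N * q ^ ((tupleSum N + 1).choose 2 + ∑ r : Fin n, (r : ℕ) * N r)
      = (-1) ^ tupleSum N := div_mul_cancel₀ _ (pow_ne_zero _ hq)
  have h4 : ((-1 : ℂ) ^ tupleSum N) * (-1) ^ tupleSum N = 1 := by rw [← mul_pow]; norm_num
  have h5 := congrArg (q ^ ·) h2
  simp only [pow_add _ (Finset.sum _ _), pow_add _ (crossSum N)] at h5
  rw [vandermondeA_mul_termFactorA_self hq hs hx, h1]
  generalize ∏ r, qFac (q / (q ^ tupleSum N * B) * x r) q (N r) = P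
  generalize (∏ r, x r ^ N r)⁻¹ = X
  linear_combination diagValue q N * (-1) ^ tupleSum N * B ^ tupleSum N * X * P * h5
    + q ^ crossSum N * (-1) ^ tupleSum N * B ^ tupleSum N * X * P * h3
    + q ^ crossSum N * B ^ tupleSum N * X * P * h4

/-- The balanced summation of type `A` with numerator factors `(B q^(|k| - k_r) / x_r; q)_{k_r}`. -/
theorem sum_saalTerm {n : ℕ} {q B C : ℂ} {x : Fin n → ℂ} (hq : q ≠ 0) (hB : B ≠ 0) (hC : C ≠ 0)
    (hx : ∀ r, x r ≠ 0) (N : Fin n → ℕ) (hs : SeparatedNodes q x N)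
    (hBC : ∀ r, ∀ i < N r + tupleSum N, C * x r * q ^ i ≠ B)
    (hCN : qFac C q (tupleSum N) ≠ 0) {D v : ℂ} (hv : v ≠ 0)
    (hD : D * C * v * q ^ tupleSum N = B * q) (hDN : qFac D q (tupleSum N) ≠ 0) :
    ∑ k ∈ indexBox N, saalTerm q B C D v x N k = saalValue q B C D x N := by
  induction hM : tupleSum N using Nat.strong_induction_on generalizing N v D with
  | _ M ih =>
  subst hM
  -- Balancing ties `D` to `v` through `D v = D₀`. Hence `v^|N| (D; q)_|N| = ∏ (v - D₀ q^i)` is a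
  -- polynomial in `v`, by which the sum can be multiplied.
  obtain ⟨D₀, hD₀⟩ : ∃ D₀, D₀ = B * q / (C * q ^ tupleSum N) := ⟨_, rfl⟩
  let F : ℂ → ℂ := fun v => ∑ k ∈ indexBox N, (vandermondeA q x k * termFactorA q x N k
    * ((∏ r, qFac (B * q ^ (tupleSum k - k r) / x r) q (k r))
        * q ^ (∑ r : Fin n, ((r : ℕ) + 1) * k r) / qFac C q (tupleSum k)))
      * (nodeProd q x k v
        * ∏ i ∈ Finset.range (tupleSum N - tupleSum k), (v - D₀ * q ^ (tupleSum k + i)))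
  let G : ℂ → ℂ := fun v => (B ^ tupleSum N * (∏ r, x r ^ N r)⁻¹ * q ^ crossSum N
    * (∏ r, qFac (C / B * x r) q (N r)) / qFac C q (tupleSum N))
      * nodeProd q (fun r => D₀ / B * x r) N v
  have hF : IsPolyOfDegreeLE (tupleSum N) F := by
    refine IsPolyOfDegreeLE.sum fun k hk => IsPolyOfDegreeLE.const_mul _ ?_
    refine ((isPolyOfDegreeLE_nodeProd q x k).mul
      (IsPolyOfDegreeLE.prod_range (k := tupleSum N - tupleSum k)
        (f := fun i v => v - D₀ * q ^ (tupleSum k + i)) fun i => ?_)).mono ?_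
    · convert IsPolyOfDegreeLE.linear (-(D₀ * q ^ (tupleSum k + i))) 1 using 2
      ring
    · have := tupleSum_mono (mem_indexBox.1 hk)
      omega
  have hG : IsPolyOfDegreeLE (tupleSum N) G :=
    (isPolyOfDegreeLE_nodeProd q (fun r => D₀ / B * x r) N).const_mul _
  have hDeq : ∀ {w D : ℂ}, w ≠ 0 → D * C * w * q ^ tupleSum N = B * q → D₀ = D * w := by
    intro w D hw h
    rw [hD₀, ← h]; field_simp
  have hFsum : ∀ {w D : ℂ}, w ≠ 0 → D * C * w * q ^ tupleSum N = B * q →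
      qFac D q (tupleSum N) ≠ 0 → F w = w ^ tupleSum N * qFac D q (tupleSum N)
        * ∑ k ∈ indexBox N, saalTerm q B C D w x N k := by
    intro w D hw hDw hDN
    have hD1 := hDeq hw hDw
    rw [Finset.mul_sum]
    refine Finset.sum_congr rfl fun k hk => ?_
    have hk' := tupleSum_mono (mem_indexBox.1 hk)
    have h1 := qFac_add D q (tupleSum k) (tupleSum N - tupleSum k)
    rw [Nat.add_sub_cancel' hk'] at h1
    have h2 := qFac_ne_zero_of_le hk' hDN
    have h3 : ∏ i ∈ Finset.range (tupleSum N - tupleSum k), (w - D₀ * q ^ (tupleSum k + i))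
        = w ^ (tupleSum N - tupleSum k)
          * qFac (D * q ^ tupleSum k) q (tupleSum N - tupleSum k) := by
      rw [qFac, show w ^ (tupleSum N - tupleSum k)
        = ∏ _i ∈ Finset.range (tupleSum N - tupleSum k), w by simp, ← Finset.prod_mul_distrib]
      refine Finset.prod_congr rfl fun i _ => ?_
      rw [hD1, pow_add]; ring
    have h4 : w ^ tupleSum N = w ^ tupleSum k * w ^ (tupleSum N - tupleSum k) := by
      rw [← pow_add, Nat.add_sub_cancel' hk']
    have h5 := mul_inv_cancel₀ h2
    rw [h3, nodeProd_eq q x k hw, saalTerm, h1, h4, div_eq_mul_inv _ (_ * _), mul_inv,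
      div_eq_mul_inv _ (qFac C q _)]
    generalize qFac (D * q ^ tupleSum k) q (tupleSum N - tupleSum k) = z₁
    generalize ∏ r, qFac (w⁻¹ * x r) q (k r) = z₂
    generalize ∏ r, qFac (B * q ^ (tupleSum k - k r) / x r) q (k r) = z₃
    generalize (qFac D q (tupleSum k)) = z₄ at *
    generalize (qFac C q (tupleSum k))⁻¹ = z₅
    linear_combination (-(vandermondeA q x k * termFactorA q x N k * z₃
      * q ^ (∑ r : Fin n, ((r : ℕ) + 1) * k r) * z₅ * w ^ tupleSum k * z₂
      * w ^ (tupleSum N - tupleSum k) * z₁)) * h5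
  have hGval : ∀ {w D : ℂ}, w ≠ 0 → D * C * w * q ^ tupleSum N = B * q →
      qFac D q (tupleSum N) ≠ 0 →
        G w = w ^ tupleSum N * qFac D q (tupleSum N) * saalValue q B C D x N := by
    intro w D hw hDw hDN
    have h1 : ∀ r, w⁻¹ * (D₀ / B * x r) = D / B * x r := fun r => by
      rw [hDeq hw hDw]; field_simp
    simp only [G, saalValue, nodeProd_eq q _ N hw, h1]
    generalize D / B = z₁
    generalize C / B = z₂
    field_simp
  have key : ∀ w, F w = G w := by
    -- Here `B / C = D₀ q^(|N|-1)`, so all terms with `|k| < |N|` vanish.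
    refine eq_of_eq_on_nodes (v₀ := B / C) hs ?_ hF hG ?_ ?_
    · intro r m hm h
      refine hBC r m (by omega) ?_
      rw [div_eq_iff hC] at h
      linear_combination -h
    · intro r m hm
      have hle := fun s => update_le (N := N) (r := r) hm.le s
      have hM := tupleSum_update N r m
      have hlt : tupleSum (Function.update N r m) < tupleSum N := by omega
      have hne : ∀ i, x r * q ^ i ≠ 0 := fun i => mul_ne_zero (hx r) (pow_ne_zero _ hq)
      have hD1 : D₀ / (x r * q ^ m) * C * (x r * q ^ m) * q ^ tupleSum N = B * q := by
        have := hx r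
        rw [hD₀]
        field_simp
      -- The smaller sum is balanced with the same `D`, since `v q^|N|` is invariant under the
      -- exchange.
      have hD2 : D₀ / (x r * q ^ m) * C * (x r * q ^ N r)
          * q ^ tupleSum (Function.update N r m) = B * q := by
        rw [← hD1, mul_assoc _ (x r * _), mul_assoc _ (x r * _), mul_assoc (x r),
          mul_assoc (x r), ← pow_add, ← pow_add, add_comm m, ← hM, add_comm (N r)]
      generalize D₀ / (x r * q ^ m) = D' at *
      have n1 : qFac D' q (tupleSum N) ≠ 0 := by
        refine qFac_ne_zero_iff.2 fun i hi h0 => hBC r (m + (tupleSum N - 1 - i)) (by omega) ?_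
        have h1 : q ^ tupleSum N = q * q ^ i * q ^ (tupleSum N - 1 - i) := by
          rw [← pow_succ', ← pow_add]; congr 1; omega
        refine mul_right_cancel₀ hq ?_
        rw [← hD1, h1, pow_add]
        linear_combination C * x r * q ^ m * q * q ^ (tupleSum N - 1 - i) * h0
      have hle' : ∀ s, Function.update N r m s + tupleSum (Function.update N r m)
          ≤ N s + tupleSum N := fun s => Nat.add_le_add (hle s) hlt.le
      have hI := ih _ hlt (Function.update N r m) (hs.mono hle)
        (fun s i hi => hBC s i (hi.trans_le (hle' s))) (qFac_ne_zero_of_le hlt.le hCN)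
        (hne (N r)) hD2 (qFac_ne_zero_of_le hlt.le n1) rfl
      rw [hFsum (hne m) hD1 n1, sum_saalTerm_swap hq B C D' hx N r hm.le, hI,
        hGval (hne m) hD1 n1, saalValue_swap hq hB hx r hm.le ?_ hCN n1]
      exact hD1
    · have hw : B / C ≠ 0 := div_ne_zero hB hC
      have hlast := saalTerm_last hq hB hs hx
      simp only [F, G]
      rw [Finset.sum_eq_single_of_mem N (mem_indexBox.2 fun _ => le_rfl), Nat.sub_self,
        Finset.prod_range_zero, nodeProd_eq q x N hw, nodeProd_eq q _ N hw]
      · have h1 : ∀ r, (B / C)⁻¹ * (D₀ / B * x r) = q / (q ^ tupleSum N * B) * x r := fun r => by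
          rw [hD₀]; field_simp
        simp only [h1]
        simp only [inv_div]
        generalize q / (q ^ tupleSum N * B) = z₁ at *
        generalize C / B = z₂ at *
        rw [← mul_div_assoc, hlast]
        ring
      · intro k hk hkN
        have := tupleSum_lt (mem_indexBox.1 hk) hkN
        rw [Finset.prod_eq_zero (i := tupleSum N - tupleSum k - 1)
          (Finset.mem_range.2 (by omega)), mul_zero, mul_zero]
        have h1 : q ^ tupleSum N = q * q ^ (tupleSum k + (tupleSum N - tupleSum k - 1)) := by
          rw [← pow_succ']; congr 1; omega
        rw [hD₀, h1]
        field_simp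
        ring
  have h1 := key v
  rw [hFsum hv hD hDN, hGval hv hD hDN] at h1
  exact mul_left_cancel₀ (mul_ne_zero (pow_ne_zero _ hv) hDN) h1

/-! ### Expanding the summand and interchanging the sums. -/

/-- The part of `sixTerm` depending on a single coordinate `y = x_r`, `M = N_r`, `l = k_r`,
with `L = |k|`. -/
noncomputable def sixFactor (q a d v y : ℂ) (M L l : ℕ) : ℂ :=
  (1 - a * y * q ^ (l + L)) / (1 - a * y) * qFac (a * y) q L / qFac (a * y * q / d) q l
    * (qFac (a * y * q ^ (1 + M)) q L)⁻¹ * qFac (v⁻¹ * y) q l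

theorem sixTerm_eq {n : ℕ} (q a d v : ℂ) (x : Fin n → ℂ) (N k : Fin n → ℕ) :
    sixTerm q a d v x N k = vandermondeA q x k * termFactorA q x N k
      * (∏ r, sixFactor q a d v (x r) (N r) (tupleSum k) (k r))
      * (qFac d q (tupleSum k) * (qFac (a * q * v) q (tupleSum k))⁻¹
        * (a * q ^ (1 + tupleSum N) * v / d) ^ tupleSum k)
      * q ^ (∑ r : Fin n, (r : ℕ) * k r) := by
  simp only [sixTerm, sixBase, sixFactor, Finset.prod_mul_distrib, Finset.prod_inv_distrib]
  ring

/-- The factor relating `sixFactor` at `l + l'` to a shifted `sixFactor` at `l'`. -/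
noncomputable def shiftFactor (q a d v y : ℂ) (M L l : ℕ) : ℂ :=
  qFac (a * y * q) q (L + l) * qFac (v⁻¹ * y) q l * (qFac (a * y * q ^ (1 + M)) q L)⁻¹
    * (qFac (a * y * q / d) q l)⁻¹

/-- The extra factor comes from the balanced sum, whose parameter is `a q^|k|`. It prolongs `(a y;
q)_{L+L'}` to `(a y; q)_{L+L'+l}`, which is then cut at `L + l` to expose the shifted base `a y
q^(L+l)`. -/
theorem sixFactor_add {q a d v y : ℂ} (hq : q ≠ 0) {M L l L' l' : ℕ} (hl : l ≤ M)
    (h0 : 1 - a * y ≠ 0) (h1 : 1 - a * y * q ^ (L + l) ≠ 0) :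
    sixFactor q a d v y M (L + L') (l + l') * qFac (a * q ^ (L + L') * y) q l
      = shiftFactor q a d v y M L l
        * sixFactor q (a * q ^ L) (d * q ^ L) v (y * q ^ l) (M - l) L' l' := by
  have e1 : a * q ^ L * (y * q ^ l) = a * y * q ^ (L + l) := by rw [pow_add]; ring
  have e2 : a * y * q ^ (L + l) * q / (d * q ^ L) = a * y * q / d * q ^ l := by
    rw [pow_add]; field_simp
  have e3 : a * y * q ^ (L + l) * q ^ (1 + (M - l)) = a * y * q ^ (1 + M) * q ^ L := by
    rw [mul_assoc (a * y), mul_assoc (a * y), ← pow_add, ← pow_add]; congr 2; omega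
  have e4 : a * y * q ^ (L + l) * q ^ (l' + L') = a * y * q ^ (l + l' + (L + L')) := by
    rw [mul_assoc, ← pow_add]; congr 2; omega
  have e5 : qFac (a * y) q (L + L') * qFac (a * q ^ (L + L') * y) q l * (1 - a * y * q ^ (L + l))
      = (1 - a * y) * qFac (a * y * q) q (L + l) * qFac (a * y * q ^ (L + l)) q L' := by
    have h2 := qFac_add (a * y) q (L + L') l
    have h3 := qFac_add (a * y) q (L + l) L'
    have h4 := qFac_add (a * y) q (L + l) 1
    rw [qFac_succ', qFac_one] at h4
    rw [show L + l + L' = L + L' + l by ring, h2] at h3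
    rw [mul_right_comm a _ y, h3]
    linear_combination -qFac (a * y * q ^ (L + l)) q L' * h4
  rw [sixFactor, sixFactor, shiftFactor, e1, e2, e3, e4, qFac_add (a * y * q / d) q l l',
    qFac_add (a * y * q ^ (1 + M)) q L L',
    qFac_add (v⁻¹ * y) q l l', ← mul_assoc v⁻¹ y, mul_inv,
    div_eq_mul_inv _ (qFac (a * y * q / d) q l * _), mul_inv,
    div_eq_mul_inv _ (qFac (a * y * q / d * q ^ l) q l')]
  generalize (qFac (a * y * q / d) q l)⁻¹ = z₁
  generalize (qFac (a * y * q / d * q ^ l) q l')⁻¹ = z₂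
  generalize (qFac (a * y * q ^ (1 + M)) q L)⁻¹ = z₃
  generalize (qFac (a * y * q ^ (1 + M) * q ^ L) q L')⁻¹ = z₄
  generalize qFac (v⁻¹ * y) q l = z₅
  generalize qFac (v⁻¹ * y * q ^ l) q l' = z₆
  generalize qFac (a * q ^ (L + L') * y) q l = z₈ at *
  generalize 1 - a * y * q ^ (l + l' + (L + L')) = z₇
  generalize 1 - a * y = w₁ at *
  generalize 1 - a * y * q ^ (L + l) = w₂ at *
  field_simp
  linear_combination z₇ * z₁ * z₂ * z₃ * z₄ * z₅ * z₆ * e5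

theorem shiftFactor_mul {q a d v y : ℂ} (hq : q ≠ 0) {M L l : ℕ} (hl : l ≤ M)
    (h0 : qFac (a * y * q ^ (1 + M)) q L ≠ 0) :
    shiftFactor q a d v y M L l * (qFac (a * q ^ L * (y * q ^ l) * q) q (M - l)
        / qFac (a * q ^ L * (y * q ^ l) * q / (d * q ^ L)) q (M - l))
      = qFac (v⁻¹ * y) q l * (qFac (a * y * q) q M / qFac (a * y * q / d) q M) := by
  have e1 : a * q ^ L * (y * q ^ l) * q = a * y * q * q ^ (L + l) := by rw [pow_add]; ring
  have e2 : a * y * q * q ^ (L + l) / (d * q ^ L) = a * y * q / d * q ^ l := by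
    rw [pow_add]; field_simp
  have e3 := qFac_add (a * y * q) q (L + l) (M - l)
  have e4 := qFac_add (a * y * q / d) q l (M - l)
  have e5 := qFac_add (a * y * q) q M L
  rw [Nat.add_sub_cancel' hl] at e4
  rw [show L + l + (M - l) = M + L by omega, e5, mul_assoc (a * y) q, ← pow_succ',
    add_comm M 1] at e3
  have h0' := mul_inv_cancel₀ h0
  rw [shiftFactor, e1, e2, e4, div_eq_mul_inv _ (qFac (a * y * q / d * q ^ l) q (M - l)),
    div_eq_mul_inv _ (qFac (a * y * q / d) q l * _), mul_inv]
  generalize (qFac (a * y * q ^ (1 + M)) q L)⁻¹ = z at *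
  generalize (qFac (a * y * q / d) q l)⁻¹ = z₁
  generalize (qFac (a * y * q / d * q ^ l) q (M - l))⁻¹ = z₂
  linear_combination qFac (v⁻¹ * y) q l * z * z₁ * z₂ * (-e3)
    + qFac (v⁻¹ * y) q l * z₁ * z₂ * qFac (a * y * q) q M * h0'

/-- With `B = aq/(bc)`, `C = aq/b`, `D = aq/c` one has `D/B = b` and `C/B = c`, so `saalValue`
supplies exactly the factors in `b` and `c`. Balancing then forces `v⁻¹ = a q^|k|`. -/
theorem wellPoisedTerm_eq_sum {n : ℕ} {q a b c d e : ℂ} {x : Fin n → ℂ} {N k : Fin n → ℕ}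
    (hq : q ≠ 0) (ha : a ≠ 0) (hb : b ≠ 0) (hc : c ≠ 0) (hx : ∀ r, x r ≠ 0)
    (hs : SeparatedNodes q x N) (hk : ∀ r, k r ≤ N r)
    (hgc : ∀ r, ∀ i < N r + tupleSum N, c * x r * q ^ i ≠ 1)
    (hab : qFac (a * q / b) q (tupleSum N) ≠ 0) (hac : qFac (a * q / c) q (tupleSum N) ≠ 0) :
    wellPoisedTerm q a b c d e x N k = ∑ j ∈ indexBox k, sixTerm q a d e⁻¹ x N k
      * saalTerm q (a * q / (b * c)) (a * q / b) (a * q / c) (a * q ^ tupleSum k)⁻¹ x k j := by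
  have hk' := tupleSum_mono hk
  have hB : a * q / (b * c) ≠ 0 := div_ne_zero (mul_ne_zero ha hq) (mul_ne_zero hb hc)
  rw [← Finset.mul_sum, sum_saalTerm hq hB (div_ne_zero (mul_ne_zero ha hq) hb) hx k (hs.mono hk)
    (fun r i hi h => hgc r i (hi.trans_le (Nat.add_le_add (hk r) hk')) (by
      field_simp at h; linear_combination h))
    (qFac_ne_zero_of_le hk' hab) (inv_ne_zero (mul_ne_zero ha (pow_ne_zero _ hq)))
    (by field_simp) (qFac_ne_zero_of_le hk' hac)]
  have e1 : a * q / c / (a * q / (b * c)) = b := by field_simp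
  have e2 : a * q / b / (a * q / (b * c)) = c := by field_simp
  have e3 : a ^ 2 * q ^ (2 + tupleSum N) / (b * c * d * e)
      = a * q / (b * c) * (a * q ^ (1 + tupleSum N) * e⁻¹ / d) := by
    rw [pow_add, pow_add]
    simp only [div_eq_mul_inv, mul_inv]
    ring
  have e4 : ∏ r, x r ^ (-(k r : ℤ)) = (∏ r, x r ^ k r)⁻¹ := by
    simp only [zpow_neg, zpow_natCast, Finset.prod_inv_distrib]
  have e5 : a * q * e⁻¹ = a * q / e := (div_eq_mul_inv _ _).symm
  rw [wellPoisedTerm, sixTerm, sixBase, saalValue, e1, e2, e3, e4, e5, inv_inv, crossSum, pow_add,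
    mul_pow]
  simp only [Finset.prod_mul_distrib, Finset.prod_inv_distrib, div_eq_mul_inv, mul_inv]
  ring

/-- The coefficient of the shifted `₆φ₅` sum after interchanging the order of summation. -/
noncomputable def shiftCoeff {n : ℕ} (q a b c d e : ℂ) (x : Fin n → ℂ) (N j : Fin n → ℕ) : ℂ :=
  vandermondeA q x j * termFactorA q x N j * diagValue q j
    * ((∏ r, qFac (a * q / (b * c) * q ^ (tupleSum j - j r) / x r) q (j r))
      * q ^ (∑ r : Fin n, ((r : ℕ) + 1) * j r)
      / (qFac (a * q / b) q (tupleSum j) * qFac (a * q / c) q (tupleSum j)))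
    * (∏ r, shiftFactor q a d e⁻¹ (x r) (N r) (tupleSum j) (j r))
    * (qFac d q (tupleSum j) * (qFac (a * q * e⁻¹) q (tupleSum j))⁻¹
      * (a * q ^ (1 + tupleSum N) * e⁻¹ / d) ^ tupleSum j)
    * q ^ (∑ r : Fin n, (r : ℕ) * j r)

theorem tupleSum_sub {n : ℕ} {N j : Fin n → ℕ} (hj : ∀ r, j r ≤ N r) :
    tupleSum (fun r => N r - j r) = tupleSum N - tupleSum j := by
  have h := tupleSum_add j fun r => N r - j r
  have h2 : (fun r => j r + (N r - j r)) = N := funext fun r => Nat.add_sub_cancel' (hj r)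
  rw [h2] at h
  omega

/-- Separates the dependence on `m`. The power `q^(|j||m|)` required by `weight_mul_weight` comes
from the argument of the `₆φ₅` series, which is `q^|j|` times that of the shifted series. -/
theorem sixTerm_mul_saalTerm {n : ℕ} {q a b c d e : ℂ} {x : Fin n → ℂ} {N j m : Fin n → ℕ}
    (hq : q ≠ 0) (hx : ∀ r, x r ≠ 0)
    (hs : SeparatedNodes q x N) (hj : ∀ r, j r ≤ N r) (hm : ∀ r, m r ≤ N r - j r)
    (hga : ∀ r, ∀ i ≤ N r + tupleSum N, 1 - a * x r * q ^ i ≠ 0) :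
    sixTerm q a d e⁻¹ x N (fun r => j r + m r)
        * saalTerm q (a * q / (b * c)) (a * q / b) (a * q / c)
          (a * q ^ tupleSum (fun r => j r + m r))⁻¹ x (fun r => j r + m r) j
      = shiftCoeff q a b c d e x N j * sixTerm q (a * q ^ tupleSum j) (d * q ^ tupleSum j) e⁻¹
          (fun r => x r * q ^ j r) (fun r => N r - j r) m := by
  have hjN := tupleSum_mono hj
  have hW := weight_mul_weight hq hs hx hj hm
  have hF : (∏ r, sixFactor q a d e⁻¹ (x r) (N r) (tupleSum j + tupleSum m) (j r + m r))
      * (∏ r, qFac (a * q ^ (tupleSum j + tupleSum m) * x r) q (j r))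
      = (∏ r, shiftFactor q a d e⁻¹ (x r) (N r) (tupleSum j) (j r))
        * ∏ r, sixFactor q (a * q ^ tupleSum j) (d * q ^ tupleSum j) e⁻¹ (x r * q ^ j r)
          (N r - j r) (tupleSum m) (m r) := by
    rw [← Finset.prod_mul_distrib, ← Finset.prod_mul_distrib]
    refine Finset.prod_congr rfl fun r _ => sixFactor_add hq (hj r) ?_ ?_
    · simpa using hga r 0 (Nat.zero_le _)
    · refine hga r _ ?_
      have := hj r
      omega
  have hZ : a * q ^ (1 + tupleSum N) * e⁻¹ / d
      = a * q ^ tupleSum j * q ^ (1 + (tupleSum N - tupleSum j)) * e⁻¹ / (d * q ^ tupleSum j)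
        * q ^ tupleSum j := by
    have : q ^ (1 + tupleSum N) = q ^ tupleSum j * q ^ (1 + (tupleSum N - tupleSum j)) := by
      rw [← pow_add]; congr 1; omega
    rw [this]
    by_cases hd : d = 0
    · simp [hd]
    · field_simp
  have e1 : a * q ^ tupleSum j * q * e⁻¹ = a * q * e⁻¹ * q ^ tupleSum j := by ring
  rw [sixTerm_eq, sixTerm_eq, saalTerm, shiftCoeff, inv_inv, tupleSum_add, tupleSum_sub hj,
    qFac_add d, qFac_add (a * q * e⁻¹), pow_add (a * q ^ (1 + tupleSum N) * e⁻¹ / d), e1]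
  have hZ2 : (a * q ^ (1 + tupleSum N) * e⁻¹ / d) ^ tupleSum m
      = (a * q ^ tupleSum j * q ^ (1 + (tupleSum N - tupleSum j)) * e⁻¹
          / (d * q ^ tupleSum j)) ^ tupleSum m * q ^ (tupleSum j * tupleSum m) := by
    rw [hZ, mul_pow, ← pow_mul]
  rw [hZ2]
  simp only [mul_add, Finset.sum_add_distrib, pow_add q (∑ r : Fin n, (r : ℕ) * j r), mul_inv]
  generalize (∏ r, sixFactor q a d e⁻¹ (x r) (N r) (tupleSum j + tupleSum m) (j r + m r)) = p₁ at *
  generalize (∏ r, qFac (a * q ^ (tupleSum j + tupleSum m) * x r) q (j r)) = p₂ at *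
  generalize (∏ r, shiftFactor q a d e⁻¹ (x r) (N r) (tupleSum j) (j r)) = p₃ at *
  generalize (∏ r, sixFactor q (a * q ^ tupleSum j) (d * q ^ tupleSum j) e⁻¹ (x r * q ^ j r)
          (N r - j r) (tupleSum m) (m r)) = p₄ at *
  generalize vandermondeA q x (fun r => j r + m r) * termFactorA q x N (fun r => j r + m r)
    = w₁ at *
  generalize vandermondeA q x j * termFactorA q x (fun r => j r + m r) j = w₂ at *
  generalize vandermondeA q x j * termFactorA q x N j = w₃ at *
  generalize vandermondeA q (fun r => x r * q ^ j r) m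
          * termFactorA q (fun r => x r * q ^ j r) (fun r => N r - j r) m = w₄ at *
  generalize (a * q ^ (1 + tupleSum N) * e⁻¹ / d) ^ tupleSum j = u₁
  generalize (a * q ^ tupleSum j * q ^ (1 + (tupleSum N - tupleSum j)) * e⁻¹
          / (d * q ^ tupleSum j)) ^ tupleSum m = u₂
  generalize ((∏ r, qFac (a * q / (b * c) * q ^ (tupleSum j - j r) / x r) q (j r))
      * q ^ (∑ r : Fin n, ((r : ℕ) + 1) * j r)
      / (qFac (a * q / b) q (tupleSum j) * qFac (a * q / c) q (tupleSum j))) = u₃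
  generalize qFac d q (tupleSum j) = u₄
  generalize qFac (d * q ^ tupleSum j) q (tupleSum m) = u₅
  generalize (qFac (a * q * e⁻¹) q (tupleSum j))⁻¹ = u₆
  generalize (qFac (a * q * e⁻¹ * q ^ tupleSum j) q (tupleSum m))⁻¹ = u₇
  generalize q ^ (∑ r : Fin n, (r : ℕ) * j r) = u₈
  generalize q ^ (∑ r : Fin n, (r : ℕ) * m r) = u₉
  linear_combination u₁ * u₂ * u₃ * u₄ * u₅ * u₆ * u₇ * u₈ * u₉ * (p₁ * p₂ * hW
    + w₃ * w₄ * diagValue q j * hF)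

/-- The shifted `₆φ₅` value supplies only the first `|N| - |j|` factors of `(aq/(de); q)_|N|`.
Reversing the missing last `|j|` factors produces the denominator `(de q^(-|N|)/a; q)_|j|` of the
balanced side. -/
theorem shiftCoeff_mul {n : ℕ} {q a b c d e : ℂ} {x : Fin n → ℂ} {N j : Fin n → ℕ}
    (hq : q ≠ 0) (ha : a ≠ 0) (hd : d ≠ 0) (he : e ≠ 0)
    (hj : ∀ r, j r ≤ N r)
    (haxN : ∀ r, qFac (a * x r * q ^ (1 + N r)) q (tupleSum N) ≠ 0)
    (hde : qFac (d * e * q ^ (-(tupleSum N : ℤ)) / a) q (tupleSum N) ≠ 0) :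
    shiftCoeff q a b c d e x N j
        * (qFac (a * q ^ tupleSum j * q / (d * q ^ tupleSum j) * e⁻¹) q (tupleSum N - tupleSum j)
            / qFac (a * q ^ tupleSum j * q * e⁻¹) q (tupleSum N - tupleSum j)
          * ∏ r, qFac (a * q ^ tupleSum j * (x r * q ^ j r) * q) q (N r - j r)
            / qFac (a * q ^ tupleSum j * (x r * q ^ j r) * q / (d * q ^ tupleSum j)) q (N r - j r))
      = qFac (a * q / (d * e)) q (tupleSum N) / qFac (a * q / e) q (tupleSum N)
        * (∏ r : Fin n, qFac (a * x r * q) q (N r) / qFac (a * x r * q / d) q (N r))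
        * balancedTerm q a b c d e x N j := by
  have hjN := tupleSum_mono hj
  have hF : (∏ r, shiftFactor q a d e⁻¹ (x r) (N r) (tupleSum j) (j r))
      * (∏ r, qFac (a * q ^ tupleSum j * (x r * q ^ j r) * q) q (N r - j r)
        / qFac (a * q ^ tupleSum j * (x r * q ^ j r) * q / (d * q ^ tupleSum j)) q (N r - j r))
      = (∏ r, qFac (e * x r) q (j r))
        * ∏ r : Fin n, qFac (a * x r * q) q (N r) / qFac (a * x r * q / d) q (N r) := by
    rw [← Finset.prod_mul_distrib, ← Finset.prod_mul_distrib]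
    refine Finset.prod_congr rfl fun r _ => ?_
    rw [shiftFactor_mul hq (hj r) (qFac_ne_zero_of_le hjN (haxN r)), inv_inv]
  have e1 : a * q ^ tupleSum j * q / (d * q ^ tupleSum j) * e⁻¹ = a * q / (d * e) := by
    field_simp
  have e2 : a * q ^ tupleSum j * q * e⁻¹ = a * q / e * q ^ tupleSum j := by
    rw [div_eq_mul_inv]; ring
  have e3 : a * q * e⁻¹ = a * q / e := (div_eq_mul_inv _ _).symm
  have e4 : ∏ r, qFac (a * q ^ (1 + (tupleSum j : ℤ) - (j r : ℤ)) / (b * c * x r)) q (j r)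
      = ∏ r, qFac (a * q / (b * c) * q ^ (tupleSum j - j r) / x r) q (j r) := by
    refine Finset.prod_congr rfl fun r _ => ?_
    have : q ^ (1 + (tupleSum j : ℤ) - (j r : ℤ)) = q * q ^ (tupleSum j - j r) := by
      rw [← pow_succ', ← zpow_natCast]
      congr 1
      have := le_tupleSum j r
      omega
    rw [this]
    simp only [div_eq_mul_inv, mul_inv]
    congr 1; ring
  have h5 := qFac_add (a * q / e) q (tupleSum j) (tupleSum N - tupleSum j)
  have h6 := qFac_add (a * q / (d * e)) q (tupleSum N - tupleSum j) (tupleSum j)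
  rw [Nat.add_sub_cancel' hjN] at h5
  rw [Nat.sub_add_cancel hjN] at h6
  have hN : q ^ tupleSum N = q ^ (tupleSum N - tupleSum j) * q ^ tupleSum j := by
    rw [← pow_add, Nat.sub_add_cancel hjN]
  have h7 := qFac_reverse (a := a * q / (d * e) * q ^ (tupleSum N - tupleSum j))
    (b := d * e * q ^ (-(tupleSum N : ℤ)) / a) hq (tupleSum j)
    (by rw [zpow_neg, zpow_natCast, hN]; field_simp)
  have h8 : diagValue q j * q ^ (∑ r : Fin n, (r : ℕ) * j r)
      * (a * q ^ (1 + tupleSum N) * e⁻¹ / d) ^ tupleSum j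
      = (-(a * q / (d * e) * q ^ (tupleSum N - tupleSum j))) ^ tupleSum j
        * q ^ (tupleSum j).choose 2 := by
    have g1 : a * q ^ (1 + tupleSum N) * e⁻¹ / d
        = a * q / (d * e) * q ^ (tupleSum N - tupleSum j) * q ^ tupleSum j := by
      rw [pow_add, hN]; field_simp
    have g2 : (q ^ tupleSum j) ^ tupleSum j
        = q ^ (tupleSum j).choose 2 * q ^ (tupleSum j + 1).choose 2 := by
      rw [← pow_mul, ← pow_add, choose_two_add_succ_choose_two]
    rw [g1, mul_pow _ (q ^ tupleSum j), g2, neg_pow, diagValue, pow_add]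
    generalize (a * q / (d * e) * q ^ (tupleSum N - tupleSum j)) ^ tupleSum j = z
    field_simp
  have h9 := qFac_ne_zero_of_le hjN hde
  rw [h7, ← h8] at h6
  rw [shiftCoeff, balancedTerm, Finset.prod_mul_distrib, e1, e2, e3, e4, h5, h6]
  generalize qFac (d * e * q ^ (-(tupleSum N : ℤ)) / a) q (tupleSum j) = z₁ at *
  simp only [div_eq_mul_inv, mul_inv] at hF ⊢
  have h10 := mul_inv_cancel₀ h9
  generalize z₁⁻¹ = z₂ at *
  generalize (a * q ^ (1 + tupleSum N) * e⁻¹ * d⁻¹) ^ tupleSum j = u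
  generalize (qFac (a * q * e⁻¹) q (tupleSum j))⁻¹ = u₆
  generalize (qFac (a * q * e⁻¹ * q ^ tupleSum j) q (tupleSum N - tupleSum j))⁻¹ = u₇
  generalize (qFac (a * q * b⁻¹) q (tupleSum j))⁻¹ = u₈
  generalize (qFac (a * q * c⁻¹) q (tupleSum j))⁻¹ = u₉
  generalize q ^ (∑ r : Fin n, (r : ℕ) * j r) = u₁
  generalize q ^ (∑ r : Fin n, ((r : ℕ) + 1) * j r) = u₂
  generalize (∏ r, qFac (a * q * (b⁻¹ * c⁻¹) * q ^ (tupleSum j - j r) * (x r)⁻¹) q (j r)) = p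
  generalize (∏ r, shiftFactor q a d e⁻¹ (x r) (N r) (tupleSum j) (j r)) = p₁ at *
  generalize (∏ r, qFac (e * x r) q (j r)) = p₂ at *
  generalize (∏ r, qFac (a * q ^ tupleSum j * (x r * q ^ j r) * q) q (N r - j r)
    * (qFac (a * q ^ tupleSum j * (x r * q ^ j r) * q * (d⁻¹ * (q ^ tupleSum j)⁻¹)) q
      (N r - j r))⁻¹) = p₃ at *
  generalize (∏ r : Fin n, qFac (a * x r * q) q (N r)
    * (qFac (a * x r * q * d⁻¹) q (N r))⁻¹) = p₄ at *
  generalize qFac (a * q * (d⁻¹ * e⁻¹)) q (tupleSum N - tupleSum j) = u₃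
  have := congrArg (vandermondeA q x j * termFactorA q x N j * diagValue q j * qFac d q (tupleSum j)
    * u * u₆ * u₇ * u₈ * u₉ * u₁ * u₂ * p * u₃ * ·) hF
  linear_combination this - vandermondeA q x j * termFactorA q x N j * diagValue q j
    * qFac d q (tupleSum j) * u * u₆ * u₇ * u₈ * u₉ * u₁ * u₂ * p * u₃ * p₂ * p₄ * h10

theorem sum_indexBox_comm {n : ℕ} (N : Fin n → ℕ) (f : (Fin n → ℕ) → (Fin n → ℕ) → ℂ) :
    ∑ k ∈ indexBox N, ∑ j ∈ indexBox k, f k j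
      = ∑ j ∈ indexBox N, ∑ m ∈ indexBox (fun r => N r - j r), f (fun r => j r + m r) j := by
  rw [Finset.sum_sigma', Finset.sum_sigma']
  refine Finset.sum_bij' (fun p _ => ⟨p.2, fun r => p.1 r - p.2 r⟩)
    (fun p _ => ⟨fun r => p.1 r + p.2 r, p.1⟩) ?_ ?_ ?_ ?_ ?_
  · rintro ⟨k, j⟩ h
    simp only [Finset.mem_sigma, mem_indexBox] at h ⊢
    exact ⟨fun r => (h.2 r).trans (h.1 r), fun r => Nat.sub_le_sub_right (h.1 r) _⟩
  · rintro ⟨j, m⟩ h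
    simp only [Finset.mem_sigma, mem_indexBox] at h ⊢
    exact ⟨fun r => by have := h.1 r; have := h.2 r; omega, fun r => Nat.le_add_right _ _⟩
  · rintro ⟨k, j⟩ h
    simp only [Finset.mem_sigma, mem_indexBox] at h
    simp only [Nat.add_sub_cancel' (h.2 _)]
  · rintro ⟨j, m⟩ h
    simp
  · rintro ⟨k, j⟩ h
    simp only [Finset.mem_sigma, mem_indexBox] at h
    simp only [Nat.add_sub_cancel' (h.2 _)]

/-! ### The transformation for generic `a` and `c`. -/

theorem transformation_of_generic {n : ℕ} {N : Fin n → ℕ} {q a b c d e : ℂ} {x : Fin n → ℂ}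
    (hq : q ≠ 0) (ha : a ≠ 0) (hb : b ≠ 0) (hc : c ≠ 0) (hd : d ≠ 0) (he : e ≠ 0)
    (hx : ∀ r, x r ≠ 0) (hs : SeparatedNodes q x N)
    (haxd : ∀ r, qFac (a * x r * q / d) q (N r) ≠ 0)
    (hab : qFac (a * q / b) q (tupleSum N) ≠ 0)
    (hac : qFac (a * q / c) q (tupleSum N) ≠ 0)
    (hae : qFac (a * q / e) q (tupleSum N) ≠ 0)
    (hde : qFac (d * e * q ^ (-(tupleSum N : ℤ)) / a) q (tupleSum N) ≠ 0)
    (hga : ∀ r, ∀ i ≤ N r + tupleSum N, 1 - a * x r * q ^ i ≠ 0)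
    (hgc : ∀ r, ∀ i < N r + tupleSum N, c * x r * q ^ i ≠ 1) :
    ∑ k ∈ indexBox N, wellPoisedTerm q a b c d e x N k
      = qFac (a * q / (d * e)) q (tupleSum N) / qFac (a * q / e) q (tupleSum N)
        * (∏ r : Fin n, qFac (a * x r * q) q (N r) / qFac (a * x r * q / d) q (N r))
        * ∑ k ∈ indexBox N, balancedTerm q a b c d e x N k := by
  have haxN : ∀ r, qFac (a * x r * q ^ (1 + N r)) q (tupleSum N) ≠ 0 := fun r =>
    qFac_ne_zero_iff.2 fun i hi => by
      rw [mul_assoc (a * x r), ← pow_add]; exact hga r _ (by omega)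
  rw [Finset.sum_congr rfl fun k hk => wellPoisedTerm_eq_sum hq ha hb hc hx hs
    (mem_indexBox.1 hk) hgc hab hac, sum_indexBox_comm, Finset.mul_sum]
  refine Finset.sum_congr rfl fun j hj => ?_
  rw [mem_indexBox] at hj
  have hjN := tupleSum_mono hj
  rw [Finset.sum_congr rfl fun m hm => sixTerm_mul_saalTerm hq hx hs hj (mem_indexBox.1 hm) hga,
    ← Finset.mul_sum, sum_sixTerm hq (mul_ne_zero ha (pow_ne_zero _ hq))
      (mul_ne_zero hd (pow_ne_zero _ hq)) (fun r => mul_ne_zero (hx r) (pow_ne_zero _ hq)) _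
      (hs.shift hj) ?_ ?_ (inv_ne_zero he) ?_, tupleSum_sub hj,
    shiftCoeff_mul hq ha hd he hj haxN hde]
  · intro r i hi
    have h1 : a * q ^ tupleSum j * (x r * q ^ j r) * q ^ i
        = a * x r * q ^ (tupleSum j + j r + i) := by
      rw [pow_add, pow_add]; ring
    rw [h1]
    rw [tupleSum_sub hj] at hi
    have := hj r
    exact hga r _ (by omega)
  · intro r
    have h1 : a * q ^ tupleSum j * (x r * q ^ j r) * q / (d * q ^ tupleSum j)
        = a * x r * q / d * q ^ j r := by
      field_simp
    have h2 := qFac_add (a * x r * q / d) q (j r) (N r - j r)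
    rw [Nat.add_sub_cancel' (hj r)] at h2
    rw [h1]
    exact right_ne_zero_of_mul (h2 ▸ haxd r)
  · have h1 : a * q ^ tupleSum j * q * e⁻¹ = a * q / e * q ^ tupleSum j := by
      rw [div_eq_mul_inv]; ring
    have h2 := qFac_add (a * q / e) q (tupleSum j) (tupleSum N - tupleSum j)
    rw [Nat.add_sub_cancel' hjN] at h2
    rw [h1, tupleSum_sub hj]
    exact right_ne_zero_of_mul (h2 ▸ hae)

/-! ### Removing genericity by continuity. -/

open Filter Topology in
theorem ContinuousAt.qFac {f : ℂ → ℂ} {t : ℂ} (hf : ContinuousAt f t) (q : ℂ) (k : ℕ) :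
    ContinuousAt (fun t => qFac (f t) q k) t := by
  unfold _root_.qFac
  fun_prop

open Filter Topology in
theorem continuousAt_finset_prod {ι : Type*} {s : Finset ι} {f : ι → ℂ → ℂ} {t : ℂ}
    (h : ∀ i ∈ s, ContinuousAt (f i) t) : ContinuousAt (fun t => ∏ i ∈ s, f i t) t :=
  tendsto_finsetProd s h

open Filter Topology in
theorem continuousAt_wellPoisedTerm {n : ℕ} {N k : Fin n → ℕ} {q a b c d e : ℂ} {x : Fin n → ℂ}
    (hb : b ≠ 0) (hc : c ≠ 0) (hd : d ≠ 0) (he : e ≠ 0)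
    (hax : ∀ r, 1 - a * x r ≠ 0)
    (haxN : ∀ r, qFac (a * x r * q ^ (1 + N r)) q (tupleSum N) ≠ 0)
    (haxd : ∀ r, qFac (a * x r * q / d) q (N r) ≠ 0)
    (hab : qFac (a * q / b) q (tupleSum N) ≠ 0)
    (hac : qFac (a * q / c) q (tupleSum N) ≠ 0)
    (hae : qFac (a * q / e) q (tupleSum N) ≠ 0) (hk : k ∈ indexBox N) :
    ContinuousAt (fun t => wellPoisedTerm q (a + t) b (c + t) d e x N k) 0 := by
  rw [mem_indexBox] at hk
  have hk' := tupleSum_mono hk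
  unfold wellPoisedTerm
  have ca : ContinuousAt (fun t : ℂ => a + t) 0 := by fun_prop
  have cc : ContinuousAt (fun t : ℂ => c + t) 0 := by fun_prop
  refine ContinuousAt.mul (ContinuousAt.mul (ContinuousAt.mul (ContinuousAt.mul
    (ContinuousAt.mul continuousAt_const ?_) continuousAt_const) ?_) ?_) continuousAt_const
  · refine continuousAt_finset_prod fun r _ => ?_
    refine ContinuousAt.div (ContinuousAt.mul (ContinuousAt.div ?_ ?_ ?_)
      (ContinuousAt.mul (ContinuousAt.mul (ContinuousAt.mul ?_ continuousAt_const) ?_)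
        continuousAt_const)) (ContinuousAt.mul ?_ ?_) ?_
    · fun_prop
    · fun_prop
    · simpa using hax r
    · exact ContinuousAt.qFac (by fun_prop) _ _
    · exact ContinuousAt.qFac (by fun_prop) _ _
    · exact ContinuousAt.qFac (by fun_prop) _ _
    · exact ContinuousAt.qFac (by fun_prop) _ _
    · rw [add_zero]
      exact mul_ne_zero (qFac_ne_zero_of_le hk' (haxN r)) (qFac_ne_zero_of_le (hk r) (haxd r))
  · refine ContinuousAt.div continuousAt_const (ContinuousAt.mul (ContinuousAt.mul ?_ ?_) ?_) ?_
    · exact ContinuousAt.qFac (by fun_prop) _ _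
    · exact ContinuousAt.qFac (ContinuousAt.div (by fun_prop) cc (by simpa using hc)) _ _
    · exact ContinuousAt.qFac (by fun_prop) _ _
    · rw [add_zero, add_zero]
      exact mul_ne_zero (mul_ne_zero (qFac_ne_zero_of_le hk' hab) (qFac_ne_zero_of_le hk' hac))
        (qFac_ne_zero_of_le hk' hae)
  · refine ContinuousAt.pow (ContinuousAt.div (by fun_prop) (by fun_prop) ?_) _
    simp [hb, hc, hd, he]

open Filter Topology in
theorem continuousAt_balancedTerm {n : ℕ} {N k : Fin n → ℕ} {q a b c d e : ℂ} {x : Fin n → ℂ}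
    (ha : a ≠ 0) (hb : b ≠ 0) (hc : c ≠ 0) (hx : ∀ r, x r ≠ 0)
    (hab : qFac (a * q / b) q (tupleSum N) ≠ 0)
    (hac : qFac (a * q / c) q (tupleSum N) ≠ 0)
    (hde : qFac (d * e * q ^ (-(tupleSum N : ℤ)) / a) q (tupleSum N) ≠ 0) (hk : k ∈ indexBox N) :
    ContinuousAt (fun t => balancedTerm q (a + t) b (c + t) d e x N k) 0 := by
  rw [mem_indexBox] at hk
  have hk' := tupleSum_mono hk
  unfold balancedTerm
  have ca : ContinuousAt (fun t : ℂ => a + t) 0 := by fun_prop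
  have cc : ContinuousAt (fun t : ℂ => c + t) 0 := by fun_prop
  refine ContinuousAt.mul (ContinuousAt.mul continuousAt_const (ContinuousAt.div
    (ContinuousAt.mul continuousAt_const ?_) (ContinuousAt.mul (ContinuousAt.mul ?_ ?_) ?_) ?_))
    continuousAt_const
  · refine continuousAt_finset_prod fun r _ => ContinuousAt.mul continuousAt_const ?_
    refine ContinuousAt.qFac (ContinuousAt.div (by fun_prop) (by fun_prop) ?_) _ _
    simp [hb, hc, hx r]
  · exact ContinuousAt.qFac (by fun_prop) _ _
  · exact ContinuousAt.qFac (ContinuousAt.div (by fun_prop) cc (by simpa using hc)) _ _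
  · exact ContinuousAt.qFac (ContinuousAt.div (by fun_prop) ca (by simpa using ha)) _ _
  · rw [add_zero, add_zero]
    exact mul_ne_zero (mul_ne_zero (qFac_ne_zero_of_le hk' hab) (qFac_ne_zero_of_le hk' hac))
      (qFac_ne_zero_of_le hk' hde)

-- At most one `t` is exceptional. The punctured neighbourhood matters, as that `t` may be `0`.
open Filter Topology in
theorem eventually_add_mul_ne_one (a y : ℂ) : ∀ᶠ t in 𝓝[≠] (0 : ℂ), (a + t) * y ≠ 1 := by
  rcases eq_or_ne y 0 with rfl | hy
  · simp
  · have h : ∀ᶠ t in 𝓝[≠] (0 : ℂ), t ≠ y⁻¹ - a := by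
      rcases eq_or_ne (y⁻¹ - a) 0 with h0 | h0
      · rw [h0]; exact self_mem_nhdsWithin
      · exact (eventually_ne_nhds h0.symm).filter_mono nhdsWithin_le_nhds
    filter_upwards [h] with t ht h1
    exact ht (eq_sub_of_add_eq' (eq_inv_of_mul_eq_one_left h1))

open Filter Topology in
theorem mainTheorem12 (n : ℕ) (N : Fin n → ℕ) (q a b c d e : ℂ) (x : Fin n → ℂ)
    (hq : q ≠ 0) (ha : a ≠ 0) (hb : b ≠ 0) (hc : c ≠ 0) (hd : d ≠ 0) (he : e ≠ 0)
    (hx : ∀ r, x r ≠ 0)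
    (hxx : ∀ r s, r < s → 1 - x r / x s ≠ 0)
    (hqx : ∀ r s, qFac (q * (x r / x s)) q (N r) ≠ 0)
    (hax : ∀ r, 1 - a * x r ≠ 0)
    (haxN : ∀ r, qFac (a * x r * q ^ (1 + N r)) q (tupleSum N) ≠ 0)
    (haxd : ∀ r, qFac (a * x r * q / d) q (N r) ≠ 0)
    (hab : qFac (a * q / b) q (tupleSum N) ≠ 0)
    (hac : qFac (a * q / c) q (tupleSum N) ≠ 0)
    (hae : qFac (a * q / e) q (tupleSum N) ≠ 0)
    (hde : qFac (d * e * q ^ (-(tupleSum N : ℤ)) / a) q (tupleSum N) ≠ 0) :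
    ∑ k ∈ indexBox N, wellPoisedTerm q a b c d e x N k
      = qFac (a * q / (d * e)) q (tupleSum N) / qFac (a * q / e) q (tupleSum N)
        * (∏ r : Fin n, qFac (a * x r * q) q (N r) / qFac (a * x r * q / d) q (N r))
        * ∑ k ∈ indexBox N, balancedTerm q a b c d e x N k := by
  have hs := separatedNodes_of_qFac_ne_zero hq hx hxx hqx
  have ca : ContinuousAt (fun t : ℂ => a + t) 0 := by fun_prop
  have cc : ContinuousAt (fun t : ℂ => c + t) 0 := by fun_prop
  have cab : ContinuousAt (fun t => qFac ((a + t) * q / b) q (tupleSum N)) 0 :=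
    ContinuousAt.qFac (by fun_prop) _ _
  have cac : ContinuousAt (fun t => qFac ((a + t) * q / (c + t)) q (tupleSum N)) 0 :=
    ContinuousAt.qFac (ContinuousAt.div (by fun_prop) cc (by simpa using hc)) _ _
  have cae : ContinuousAt (fun t => qFac ((a + t) * q / e) q (tupleSum N)) 0 :=
    ContinuousAt.qFac (by fun_prop) _ _
  have caxd : ∀ r, ContinuousAt (fun t => qFac ((a + t) * x r * q / d) q (N r)) 0 := fun r =>
    ContinuousAt.qFac (by fun_prop) _ _
  have cde : ContinuousAt
      (fun t => qFac (d * e * q ^ (-(tupleSum N : ℤ)) / (a + t)) q (tupleSum N)) 0 :=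
    ContinuousAt.qFac (ContinuousAt.div (by fun_prop) ca (by simpa using ha)) _ _
  have cL : ContinuousAt
      (fun t => ∑ k ∈ indexBox N, wellPoisedTerm q (a + t) b (c + t) d e x N k) 0 :=
    tendsto_finsetSum _ fun k hk =>
      continuousAt_wellPoisedTerm hb hc hd he hax haxN haxd hab hac hae hk
  have cR : ContinuousAt (fun t =>
      qFac ((a + t) * q / (d * e)) q (tupleSum N) / qFac ((a + t) * q / e) q (tupleSum N)
        * (∏ r : Fin n, qFac ((a + t) * x r * q) q (N r) / qFac ((a + t) * x r * q / d) q (N r))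
        * ∑ k ∈ indexBox N, balancedTerm q (a + t) b (c + t) d e x N k) 0 := by
    refine ContinuousAt.mul (ContinuousAt.mul (ContinuousAt.div ?_ cae (by simpa using hae)) ?_) ?_
    · exact ContinuousAt.qFac (by fun_prop) _ _
    · exact continuousAt_finset_prod fun r _ =>
        ContinuousAt.div (ContinuousAt.qFac (by fun_prop) _ _) (caxd r) (by simpa using haxd r)
    · exact tendsto_finsetSum _ fun k hk => continuousAt_balancedTerm ha hb hc hx hab hac hde hk
  have ev : ∀ {f : ℂ → ℂ}, ContinuousAt f 0 → f 0 ≠ 0 → ∀ᶠ t in 𝓝[≠] (0 : ℂ), f t ≠ 0 :=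
    fun hf h0 => (hf.eventually_ne h0).filter_mono nhdsWithin_le_nhds
  -- Only finitely many conditions are imposed on `t`. Distinctness of the nodes involves `q` and
  -- `x` alone, so it survives the perturbation.
  have hga : ∀ᶠ t in 𝓝[≠] (0 : ℂ), ∀ r, ∀ i ∈ Finset.range (N r + tupleSum N + 1),
      (a + t) * (x r * q ^ i) ≠ 1 :=
    eventually_all.2 fun r => (eventually_all_finset _).2 fun i _ => eventually_add_mul_ne_one _ _
  have hgc : ∀ᶠ t in 𝓝[≠] (0 : ℂ), ∀ r, ∀ i ∈ Finset.range (N r + tupleSum N),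
      (c + t) * (x r * q ^ i) ≠ 1 :=
    eventually_all.2 fun r => (eventually_all_finset _).2 fun i _ => eventually_add_mul_ne_one _ _
  have heq : (fun t => ∑ k ∈ indexBox N, wellPoisedTerm q (a + t) b (c + t) d e x N k)
      =ᶠ[𝓝[≠] 0] fun t =>
      qFac ((a + t) * q / (d * e)) q (tupleSum N) / qFac ((a + t) * q / e) q (tupleSum N)
        * (∏ r : Fin n, qFac ((a + t) * x r * q) q (N r) / qFac ((a + t) * x r * q / d) q (N r))
        * ∑ k ∈ indexBox N, balancedTerm q (a + t) b (c + t) d e x N k := by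
    filter_upwards [hga, hgc, ev ca (by simpa using ha), ev cc (by simpa using hc),
      ev cab (by simpa using hab), ev cac (by simpa using hac), ev cae (by simpa using hae),
      ev cde (by simpa using hde),
      eventually_all.2 fun r => ev (caxd r) (by simpa using haxd r)]
      with t h1 h2 h3 h4 h5 h6 h7 h8 h9
    refine transformation_of_generic hq h3 hb h4 hd he hx hs h9 h5 h6 h7 h8 ?_ ?_
    · intro r i hi h
      exact h1 r i (Finset.mem_range.2 (by omega)) (by linear_combination -h)
    · intro r i hi h
      exact h2 r i (Finset.mem_range.2 hi) (by linear_combination h)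
  have := tendsto_nhds_unique (cL.tendsto.mono_left nhdsWithin_le_nhds)
    ((cR.tendsto.mono_left nhdsWithin_le_nhds).congr' heq.symm)
  simpa only [add_zero] using this
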